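/- For a complete connected noncompact Riemannian $n$-manifold $(M,g)$ and $p\in M$, write $\mathrm{vol}(B_R(p))=R^{e(R)}$ for $R>1$, and put $\mathrm{IV}(M)=\liminf_{R\to\infty}e(R)$, $\mathrm{SV}(M)=\limsup_{R\to\infty}e(R)$ (these do not depend on $p$). For every integer $n\ge 2$ there is an open (i.e. complete, connected and noncompact) Riemannian $n$-manifold $M$ with nonnegative sectional curvature such that, with respect to every base point, $\mathrm{IV}(M)=1$ and $\mathrm{SV}(M)=n$. Moreover, $M$ can be taken to be $\mathbb{R}^n$ with a smooth Riemannian metric which, in polar coordinates $(t,\theta)\in(0,\infty)\times S^{n-1}$, is the rotationally symmetric metric $dt^2+f(t)^2\,ds^2$, where $ds^2$ is the canonical metric of the unit sphere and $f:[0,\infty)\to[0,\infty)$ is a smooth concave function with the following properties: $f(t)=t$ on $[0,1]$, and there is a sequence $R_0=1,R_1,R_2,\dots$ with $R_{j+1}>(R_j+1)^2+1$ for all $j\ge 0$ such that, for every integer $l\ge 1$, $f(t)=t^{1/(l+1)}$ on $[R_{4l-3}+1,\,R_{4l-2}-1]$ and $f(t)=t^{1-1/(l+1)}$ on $[R_{4l-1}+1,\,R_{4l}-1]$.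 -/

import Mathlib

open scoped Manifold ContDiff ENNReal Topology

noncomputable section

namespace RiemannianGeometry

/-- A smooth Riemannian metric on a smooth `n`-manifold `M` (without boundary, modelled on
`EuclideanSpace ℝ (Fin n)`): a smooth family of inner products on the tangent spaces. -/
abbrev Metric (n : ℕ) (M : Type*) [TopologicalSpace M]
    [ChartedSpace (EuclideanSpace ℝ (Fin n)) M] [IsManifold (𝓡 n) ∞ M] :=
  Bundle.ContMDiffRiemannianMetric (𝓡 n) ∞ (EuclideanSpace ℝ (Fin n))
    (fun x : M => TangentSpace (𝓡 n) x)

namespace Metric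

variable {n : ℕ} {M : Type*} [TopologicalSpace M]
  [ChartedSpace (EuclideanSpace ℝ (Fin n)) M] [IsManifold (𝓡 n) ∞ M]

/-! ### Distance, balls, completeness -/

section Distance

open scoped Bundle

/-- The Riemannian distance: the infimum of the `g`-lengths of the `C¹` paths from `p` to `q`
(with value `∞` if there is no such path). -/
def riemDist (g : Metric n M) (p q : M) : ℝ≥0∞ :=
  letI : Bundle.RiemannianBundle (fun x : M => TangentSpace (𝓡 n) x) := ⟨g.toRiemannianMetric⟩
  Manifold.riemannianEDist (𝓡 n) p q

end Distance

/-- The open metric ball `B_R(p)`. -/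
def ball (g : Metric n M) (p : M) (R : ℝ) : Set M :=
  {q | g.riemDist p q < ENNReal.ofReal R}

/-- Metric completeness: every Cauchy sequence for the Riemannian distance converges. -/
def IsComplete (g : Metric n M) : Prop :=
  ∀ u : ℕ → M,
    (∀ ε : ℝ≥0∞, 0 < ε → ∃ N : ℕ, ∀ i j : ℕ, N ≤ i → N ≤ j → g.riemDist (u i) (u j) < ε) →
    ∃ p : M, Filter.Tendsto (fun i => g.riemDist (u i) p) Filter.atTop (𝓝 0)

/-- An open Riemannian manifold: connected (Hausdorff, second countable), complete and
noncompact. -/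
structure IsOpenManifold (g : Metric n M) : Prop where
  t2 : T2Space M
  secondCountable : SecondCountableTopology M
  connected : ConnectedSpace M
  noncompact : NoncompactSpace M
  complete : g.IsComplete

/-! ### Local coordinates, curvature

All the functions below are expressed in the coordinates `y ∈ ℝⁿ` of the preferred chart
`chartAt _ x` around `x : M`; they are meaningful for `y` in the target of that chart. -/

/-- The `i`-th vector of the standard basis of `ℝⁿ`. -/
def stdVec (i : Fin n) : EuclideanSpace ℝ (Fin n) := EuclideanSpace.single i 1

/-- The coordinate vector field `∂ᵢ` of the chart around `x`, at the point with coordinates `y`. -/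
def coordField (x : M) (y : EuclideanSpace ℝ (Fin n)) (i : Fin n) :
    TangentSpace (𝓡 n) ((chartAt (EuclideanSpace ℝ (Fin n)) x).symm y) :=
  mfderiv (𝓡 n) (𝓡 n) (chartAt (EuclideanSpace ℝ (Fin n)) x).symm y (stdVec i)

/-- The matrix of the metric in coordinates, `g_ij = g(∂ᵢ, ∂ⱼ)`. -/
def coeff (g : Metric n M) (x : M) (y : EuclideanSpace ℝ (Fin n)) :
    Matrix (Fin n) (Fin n) ℝ :=
  Matrix.of fun i j =>
    g.inner ((chartAt (EuclideanSpace ℝ (Fin n)) x).symm y) (coordField x y i) (coordField x y j)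

/-- The partial derivative `∂ᵢ F` of a function on `ℝⁿ`. -/
def partialDeriv (F : EuclideanSpace ℝ (Fin n) → ℝ) (i : Fin n)
    (y : EuclideanSpace ℝ (Fin n)) : ℝ :=
  fderiv ℝ F y (stdVec i)

/-- The Christoffel symbols of the Levi-Civita connection,
`Γᵏ_ij = ½ ∑ₗ gᵏˡ (∂ᵢ g_jl + ∂ⱼ g_il - ∂ₗ g_ij)`. -/
def christoffel (g : Metric n M) (x : M) (k i j : Fin n)
    (y : EuclideanSpace ℝ (Fin n)) : ℝ :=
  (1 / 2 : ℝ) * ∑ l, (g.coeff x y)⁻¹ k l *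
    (partialDeriv (fun z => g.coeff x z j l) i y + partialDeriv (fun z => g.coeff x z i l) j y
      - partialDeriv (fun z => g.coeff x z i j) l y)

/-- The components `Rˡ_kij` of the curvature tensor,
`R(∂ᵢ, ∂ⱼ)∂ₖ = ∇_∂ᵢ ∇_∂ⱼ ∂ₖ - ∇_∂ⱼ ∇_∂ᵢ ∂ₖ = ∑ₗ Rˡ_kij ∂ₗ`. -/
def riemannTensor (g : Metric n M) (x : M) (l k i j : Fin n)
    (y : EuclideanSpace ℝ (Fin n)) : ℝ :=
  partialDeriv (g.christoffel x l j k) i y - partialDeriv (g.christoffel x l i k) j y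
    + ∑ m, (g.christoffel x l i m y * g.christoffel x m j k y
        - g.christoffel x l j m y * g.christoffel x m i k y)

/-- The inner product `g(u, v)` of tangent vectors `u = ∑ uⁱ ∂ᵢ` and `v = ∑ vⁱ ∂ᵢ` at `x`, in the
coordinates around `x`. -/
def innerAt (g : Metric n M) (x : M) (u v : Fin n → ℝ) : ℝ :=
  ∑ i, ∑ j, g.coeff x (chartAt (EuclideanSpace ℝ (Fin n)) x x) i j * u i * v j

/-- The components of the tangent vector `R(u, v)w` at `x`, in the coordinates around `x`. -/
def curvatureAt (g : Metric n M) (x : M) (u v w : Fin n → ℝ) (l : Fin n) : ℝ :=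
  ∑ i, ∑ j, ∑ k,
    g.riemannTensor x l k i j (chartAt (EuclideanSpace ℝ (Fin n)) x x) * u i * v j * w k

/-- The sectional curvature of the plane in `T_x M` spanned by the (linearly independent) vectors
`u = ∑ uⁱ ∂ᵢ` and `v = ∑ vⁱ ∂ᵢ`:
`g(R(u, v)v, u) / (g(u, u) g(v, v) - g(u, v)²)`. -/
def sectionalCurvature (g : Metric n M) (x : M) (u v : Fin n → ℝ) : ℝ :=
  g.innerAt x (g.curvatureAt x u v v) u /
    (g.innerAt x u u * g.innerAt x v v - g.innerAt x u v ^ 2)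

/-- `sec ≥ 0`: all the sectional curvatures are nonnegative. -/
def NonnegSectionalCurvature (g : Metric n M) : Prop :=
  ∀ (x : M) (u v : Fin n → ℝ), LinearIndependent ℝ ![u, v] → 0 ≤ g.sectionalCurvature x u v

/-! ### Volume and volume growth -/

/-- The Riemannian measure on the domain of the chart around `x`: the image under the inverse
chart of the measure `√(det g_ij) dy¹ ⋯ dyⁿ` on the target of the chart. -/
def chartVolume [MeasurableSpace M] (g : Metric n M) (x : M) : MeasureTheory.Measure M :=
  MeasureTheory.Measure.map (chartAt (EuclideanSpace ℝ (Fin n)) x).symm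
    (((MeasureTheory.volume : MeasureTheory.Measure (EuclideanSpace ℝ (Fin n))).restrict
        (chartAt (EuclideanSpace ℝ (Fin n)) x).target).withDensity
      (fun y => ENNReal.ofReal (Real.sqrt (g.coeff x y).det)))

/-- The Riemannian volume measure: the smallest measure which dominates the Riemannian measure of
every chart domain. (The measures `chartVolume` agree on overlaps of chart domains, so on a
second countable manifold this is the measure which restricts to `g.chartVolume x` on
the domain of the chart around `x`, for every `x`.) -/
def vol [MeasurableSpace M] (g : Metric n M) : MeasureTheory.Measure M :=
  ⨆ x : M, g.chartVolume x

/-- The volume order function `R ↦ log vol(B_R(p)) / log R`: for `R > 1` this is the exponent `e`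
with `vol(B_R(p)) = R ^ e`. -/
def volumeOrder [MeasurableSpace M] (g : Metric n M) (p : M) (R : ℝ) : EReal :=
  ENNReal.log (g.vol (g.ball p R)) / ((Real.log R : ℝ) : EReal)

/-- `IV(M)`, the infimum of the volume growth order, computed with the base point `p`. -/
def IV [MeasurableSpace M] (g : Metric n M) (p : M) : EReal :=
  Filter.liminf (g.volumeOrder p) Filter.atTop

/-- `SV(M)`, the supremum of the volume growth order, computed with the base point `p`. -/
def SV [MeasurableSpace M] (g : Metric n M) (p : M) : EReal :=
  Filter.limsup (g.volumeOrder p) Filter.atTop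

/-! ### Rotationally symmetric metrics -/

/-- The metric `g` on `ℝⁿ` is `dt² + f(t)² ds²` in polar coordinates
`(0, ∞) × S^{n-1} → ℝⁿ ∖ {0}`, `(t, θ) ↦ tθ`, where `ds²` is the canonical metric of the unit
sphere. The differential of polar coordinates at `(t, θ)` maps `(a, ξ)`, where `a ∈ ℝ` and
`ξ ⊥ θ`, to `a θ + t ξ`. -/
def IsRotationallySymmetric (g : Metric n (EuclideanSpace ℝ (Fin n))) (f : ℝ → ℝ) : Prop :=
  ∀ (t : ℝ) (θ : EuclideanSpace ℝ (Fin n)), 0 < t → ‖θ‖ = 1 →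
    ∀ (a b : ℝ) (ξ η : EuclideanSpace ℝ (Fin n)), inner ℝ θ ξ = 0 → inner ℝ θ η = 0 →
      g.inner (t • θ) (a • θ + t • ξ : EuclideanSpace ℝ (Fin n))
        (b • θ + t • η : EuclideanSpace ℝ (Fin n)) = a * b + f t ^ 2 * inner ℝ ξ η

end Metric

/-- A smooth concave function `f : [0, ∞) → [0, ∞)` with `f(t) = t` on `[0, 1]` that alternates
between the powers `t^{1/(l+1)}` and `t^{1-1/(l+1)}`, `l = 1, 2, …`, on intervals whose endpoints
grow at least quadratically. -/
structure IsAlternatingWarping (f : ℝ → ℝ) (R : ℕ → ℝ) : Prop where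
  smooth : ContDiffOn ℝ ∞ f (Set.Ici 0)
  concave : ConcaveOn ℝ (Set.Ici 0) f
  nonneg : ∀ t : ℝ, 0 ≤ t → 0 ≤ f t
  near_zero : ∀ t ∈ Set.Icc (0 : ℝ) 1, f t = t
  start : R 0 = 1
  growth : ∀ j : ℕ, (R j + 1) ^ 2 + 1 < R (j + 1)
  slow : ∀ l : ℕ, 1 ≤ l → ∀ t ∈ Set.Icc (R (4 * l - 3) + 1) (R (4 * l - 2) - 1),
    f t = t ^ (1 / ((l : ℝ) + 1))
  fast : ∀ l : ℕ, 1 ≤ l → ∀ t ∈ Set.Icc (R (4 * l - 1) + 1) (R (4 * l) - 1),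
    f t = t ^ (1 - 1 / ((l : ℝ) + 1))

end RiemannianGeometry

end

/-! For `dt² + f(t)² ds²` on ℝⁿ the volume of the ball of radius R about the origin is comparable,
up to constants, to R f(R)^(n-1) as soon as f is nondecreasing and f(t)/t is nonincreasing: bound
the density (f(t)/t)^(n-1) below by its value at R, and f(t)^(n-1) above by f(R)^(n-1)
(`le_warpedMetric_vol_ball`, `warpedMetric_vol_ball_le`). Where f is t^ε the order is therefore near
1 + (n-1)ε. An f alternating between exponents tending to 0 and to 1 on ever longer intervals gives
liminf 1 and limsup n, the extreme values allowed by 1 ≤ f(t) ≤ t for t ≥ 1 (`liminf_limsup_order`).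
Moving the base point to p only shifts R by at most ‖p‖, which is invisible in log R.

The sectional curvatures lie between the radial value -f''/f and the tangential value (1 - f'²)/f².
Both are nonnegative when f is concave, nondecreasing and f'(0) = 1, so everything rests on a smooth
concave alternating f.

To pass from t^α to t^β at any stage, leave the first graph along its tangent at a, turn down at c,
and meet the second graph tangentially at a very distant b. Because b^β tends to infinity but is
o(b), the two tangent lines do cross at a point far from both a and b
(`exists_powTangent_crossing`). The concave function so obtained is smoothed within distance 1 of
each junction without changing it elsewhere. Each passage is a concave correction added to the
identity and vanishing to the left of c - 1, so the infinite sum is locally finite, smooth and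
concave (`concaveOn_bend`, `IsBendSequence.bendLimit_eq`). -/

noncomputable section

/-! ### Smoothing the corners of concave functions -/

namespace SmoothCorner

/-- The slope of `ramp`: a smooth monotone function rising from `0` to `1` on `[-1, 1]`. -/
def slope (z : ℝ) : ℝ := Real.smoothTransition ((z + 1) / 2)

/-- A smooth convex function equal to `max z 0` for `|z| ≥ 1`. -/
def ramp (z : ℝ) : ℝ := ∫ t in (-1 : ℝ)..z, slope t

lemma contDiff_slope : ContDiff ℝ ∞ slope := by
  unfold slope
  fun_prop

lemma monotone_slope : Monotone slope := fun x y h =>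
  Real.smoothTransition.monotone (by linarith)

lemma slope_nonneg (z : ℝ) : 0 ≤ slope z := Real.smoothTransition.nonneg _
lemma slope_le_one (z : ℝ) : slope z ≤ 1 := Real.smoothTransition.le_one _

lemma slope_of_le {z : ℝ} (h : z ≤ -1) : slope z = 0 :=
  Real.smoothTransition.zero_of_nonpos (by linarith)

/-- This symmetry makes `ramp z` equal to z for z ≥ 1 with no additive constant, so that smoothing
leaves no trace outside the unit windows. -/
lemma slope_add_slope_neg (z : ℝ) : slope z + slope (-z) = 1 := by
  have h := Real.smoothTransition.pos_denom ((z + 1) / 2)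
  unfold slope Real.smoothTransition
  rw [show (-z + 1) / 2 = 1 - (z + 1) / 2 by ring, show 1 - (1 - (z + 1) / 2) = (z + 1) / 2 by ring,
    add_comm (expNegInvGlue (1 - (z + 1) / 2)), ← add_div, div_self h.ne']

lemma hasDerivAt_ramp (z : ℝ) : HasDerivAt ramp (slope z) z :=
  intervalIntegral.integral_hasDerivAt_right
    (contDiff_slope.continuous.intervalIntegrable _ _)
    contDiff_slope.continuous.stronglyMeasurable.stronglyMeasurableAtFilter
    contDiff_slope.continuous.continuousAt

lemma contDiff_ramp : ContDiff ℝ ∞ ramp := by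
  rw [contDiff_infty_iff_deriv]
  refine ⟨fun z => (hasDerivAt_ramp z).differentiableAt, ?_⟩
  rw [show deriv ramp = slope from funext fun z => (hasDerivAt_ramp z).deriv]
  exact contDiff_slope

lemma ramp_of_le {z : ℝ} (h : z ≤ -1) : ramp z = 0 := by
  unfold ramp
  rw [intervalIntegral.integral_symm, intervalIntegral.integral_congr (g := fun _ => 0)]
  · simp
  · intro t ht
    rw [Set.uIcc_of_le h] at ht
    exact slope_of_le ht.2

lemma ramp_sub_ramp_neg (z : ℝ) : ramp z - ramp (-z) = z := by
  have h : ∀ x, HasDerivAt (fun y => ramp y - ramp (-y) - y) 0 x := fun x => by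
    have := ((hasDerivAt_ramp x).sub ((hasDerivAt_ramp (-x)).comp x (hasDerivAt_neg x))).sub
      (hasDerivAt_id x)
    exact this.congr_deriv (by linarith [slope_add_slope_neg x])
  have := is_const_of_deriv_eq_zero (fun x => (h x).differentiableAt) (fun x => (h x).deriv) z 0
  simp at this
  linarith

lemma ramp_of_ge {z : ℝ} (h : 1 ≤ z) : ramp z = z := by
  have := ramp_sub_ramp_neg z
  rwa [ramp_of_le (z := -z) (by linarith), sub_zero] at this

lemma monotone_ramp : Monotone ramp :=
  monotone_of_deriv_nonneg (fun z => (hasDerivAt_ramp z).differentiableAt)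
    fun z => by rw [(hasDerivAt_ramp z).deriv]; exact slope_nonneg z

lemma ramp_sub_le {z d : ℝ} (hd : 0 ≤ d) : ramp z - ramp (z - d) ≤ d := by
  have h : Antitone (fun z => ramp z - z) := by
    refine antitone_of_deriv_nonpos
      (fun z => ((hasDerivAt_ramp z).sub (hasDerivAt_id z)).differentiableAt) fun z => ?_
    rw [show (fun z => ramp z - z) = ramp - id from rfl,
      ((hasDerivAt_ramp z).sub (hasDerivAt_id z)).deriv]
    linarith [slope_le_one z]
  have := h (show z - d ≤ z by linarith)
  simp only at this
  linarith

lemma hasDerivAt_ramp_sub (d t : ℝ) :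
    HasDerivAt (fun t => ramp (t - d)) (slope (t - d)) t :=
  (hasDerivAt_ramp (t - d)).comp_sub_const t d

/-- The correction which turns the tangent line at `b` of a function with values `u` and slopes
`du` into the function itself on `[b, a]` and then into the tangent line at `a`, with
rounded corners; it is preceded by a corner at `c` lowering the slope by `κ`. -/
def bend (u du : ℝ → ℝ) (κ c b a t : ℝ) : ℝ :=
  -κ * ramp (t - c) + (u (b + ramp (t - b) - ramp (t - a)) - u b - du b * ramp (t - b)
    + du a * ramp (t - a))

section bend

variable {u du : ℝ → ℝ} {κ c b a : ℝ}

lemma bend_of_le (hcb : c ≤ b) (hba : b ≤ a) {t : ℝ} (ht : t ≤ c - 1) :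
    bend u du κ c b a t = 0 := by
  simp [bend, ramp_of_le (z := t - c) (by linarith), ramp_of_le (z := t - b) (by linarith),
    ramp_of_le (z := t - a) (by linarith)]

lemma bend_mid (hcb : c ≤ b) {t : ℝ} (h1 : b + 1 ≤ t) (h2 : t ≤ a - 1) :
    bend u du κ c b a t = -κ * (t - c) + (u t - u b - du b * (t - b)) := by
  simp [bend, ramp_of_ge (z := t - c) (by linarith), ramp_of_ge (z := t - b) (by linarith),
    ramp_of_le (z := t - a) (by linarith)]

lemma bend_of_ge (hcb : c ≤ b) (hba : b ≤ a) {t : ℝ} (ht : a + 1 ≤ t) :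
    bend u du κ c b a t = -κ * (t - c) + (u a - u b - du b * (t - b) + du a * (t - a)) := by
  simp [bend, ramp_of_ge (z := t - c) (by linarith), ramp_of_ge (z := t - b) (by linarith),
    ramp_of_ge (z := t - a) (by linarith)]

/-- `ramp` is monotone and 1-Lipschitz, so the smoothed clamp never leaves [b, a]; hence u has to be
regular only there, away from the singularity of a power at 0. -/
lemma clamp_mem (hba : b ≤ a) (t : ℝ) : b + ramp (t - b) - ramp (t - a) ∈ Set.Icc b a := by
  have h1 := monotone_ramp (show t - a ≤ t - b by linarith)
  have h2 := ramp_sub_le (z := t - b) (d := a - b) (by linarith)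
  rw [show t - b - (a - b) = t - a by ring] at h2
  constructor <;> linarith

lemma hasDerivAt_bend (hba : b ≤ a) (hu : ∀ s ∈ Set.Icc b a, HasDerivAt u (du s) s) (t : ℝ) :
    HasDerivAt (bend u du κ c b a)
      (-κ * slope (t - c) + (du (b + ramp (t - b) - ramp (t - a)) * (slope (t - b) - slope (t - a))
        - du b * slope (t - b) + du a * slope (t - a))) t := by
  have hr := fun d => hasDerivAt_ramp_sub d t
  have hs := ((hr b).const_add b).sub (hr a)
  have := (((hu _ (clamp_mem hba t)).comp t hs).sub_const (u b)).sub ((hr b).const_mul (du b))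
  exact ((hr c).const_mul (-κ)).add (this.add ((hr a).const_mul (du a)))

lemma concaveOn_bend (hba : b ≤ a) (hκ : 0 ≤ κ) (hu : ∀ s ∈ Set.Icc b a, HasDerivAt u (du s) s)
    (hdu : AntitoneOn du (Set.Icc b a)) : ConcaveOn ℝ Set.univ (bend u du κ c b a) := by
  have hd := hasDerivAt_bend (κ := κ) (c := c) hba hu
  refine Antitone.concaveOn_univ_of_deriv (fun t => (hd t).differentiableAt) fun t t' htt => ?_
  rw [(hd t).deriv, (hd t').deriv]
  have e1 := monotone_slope (show t - c ≤ t' - c by linarith)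
  have e2 := monotone_slope (show t - b ≤ t' - b by linarith)
  have e3 := monotone_slope (show t - a ≤ t' - a by linarith)
  have e4 := monotone_slope (show t' - a ≤ t' - b by linarith)
  have m := clamp_mem hba t
  have m' := clamp_mem hba t'
  have hmono : b + ramp (t - b) - ramp (t - a) ≤ b + ramp (t' - b) - ramp (t' - a) := by
    have : Monotone (fun t => b + ramp (t - b) - ramp (t - a)) := by
      have hr := hasDerivAt_ramp_sub
      refine monotone_of_deriv_nonneg
        (fun t => (((hr b t).const_add b).sub (hr a t)).differentiableAt) fun t => ?_
      rw [show (fun t => b + ramp (t - b) - ramp (t - a)) =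
        (fun t => b + ramp (t - b)) - fun t => ramp (t - a) from rfl,
        (((hr b t).const_add b).sub (hr a t)).deriv]
      linarith [monotone_slope (show t - a ≤ t - b by linarith)]
    exact this htt
  have q := hdu m m' hmono
  have qb := hdu (Set.left_mem_Icc.2 hba) m m.1
  have qa := hdu m (Set.right_mem_Icc.2 hba) m.2
  generalize du (b + ramp (t - b) - ramp (t - a)) = x at *
  generalize du (b + ramp (t' - b) - ramp (t' - a)) = y at *
  -- With σ for the slopes, the drop of the derivative from t to t' is exactly κ(σc' - σc) + (du b -
  -- x)(σb' - σb) + (x - du a)(σa' - σa) + (x - y)(σb' - σa'), a sum of four nonnegative products.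
  nlinarith [mul_nonneg hκ (sub_nonneg.2 e1), mul_nonneg (sub_nonneg.2 qb) (sub_nonneg.2 e2),
    mul_nonneg (sub_nonneg.2 qa) (sub_nonneg.2 e3), mul_nonneg (sub_nonneg.2 q) (sub_nonneg.2 e4)]

lemma contDiff_bend (hba : b ≤ a) (hu : ∀ s ∈ Set.Icc b a, ContDiffAt ℝ ∞ u s) :
    ContDiff ℝ ∞ (bend u du κ c b a) := by
  have hr : ∀ d, ContDiff ℝ ∞ fun t => ramp (t - d) := fun d =>
    contDiff_ramp.comp (contDiff_id.sub contDiff_const)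
  have hs : ContDiff ℝ ∞ fun t => u (b + ramp (t - b) - ramp (t - a)) :=
    contDiff_iff_contDiffAt.2 fun t => ContDiffAt.comp t (hu _ (clamp_mem hba t))
      (((contDiff_const (c := b)).add (hr b)).sub (hr a)).contDiffAt
  exact (contDiff_const.mul (hr c)).add (((hs.sub contDiff_const).sub
    (contDiff_const.mul (hr b))).add (contDiff_const.mul (hr a)))

end bend

end SmoothCorner

/-! ### Following successive powers along tangent lines -/

/-- The derivative of `t ↦ t ^ α` on `(0, ∞)`. -/
def powSlope (α t : ℝ) : ℝ := α * t ^ (α - 1)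

/-- The tangent line at `a` to the graph of `t ↦ t ^ α`. -/
def powTangent (α a t : ℝ) : ℝ := a ^ α + powSlope α a * (t - a)

lemma hasDerivAt_pow_powSlope (α : ℝ) {t : ℝ} (ht : 0 < t) :
    HasDerivAt (fun s : ℝ => s ^ α) (powSlope α t) t :=
  Real.hasDerivAt_rpow_const (Or.inl ht.ne')

lemma powSlope_antitoneOn {α b a : ℝ} (h0 : 0 ≤ α) (h1 : α ≤ 1) (hb : 0 < b) :
    AntitoneOn (powSlope α) (Set.Icc b a) := fun x hx y _ hxy =>
  mul_le_mul_of_nonneg_left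
    (Real.rpow_le_rpow_of_nonpos (hb.trans_le hx.1) hxy (by linarith)) h0

lemma powSlope_pos {α t : ℝ} (hα : 0 < α) (ht : 0 < t) : 0 < powSlope α t :=
  mul_pos hα (Real.rpow_pos_of_pos ht _)

/-- The tangent at b has intercept (1 - β) b^β and slope β b^(β-1). As b grows the intercept tends
to infinity, the slope tends to 0, and the intercept is o(b); the crossing abscissa c, a difference
of intercepts over a difference of slopes, therefore tends to infinity while c = o(b) up to a
bounded term. -/
lemma exists_powTangent_crossing {α β a : ℝ} (hα : 0 < α) (hβ : 0 < β) (hβ1 : β < 1)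
    (ha : 1 ≤ a) (B : ℝ) :
    ∃ b c, B ≤ b ∧ a + 2 ≤ c ∧ c + 2 ≤ b ∧ powSlope β b ≤ powSlope α a ∧
      powTangent α a c = powTangent β b c := by
  have hm : 0 < powSlope α a := powSlope_pos hα (by linarith)
  set m := powSlope α a
  set i := a ^ α - m * a with hi
  have t1 : Filter.Tendsto (fun b : ℝ => b ^ (β - 1)) Filter.atTop (𝓝 0) := by
    simpa using tendsto_rpow_neg_atTop (show 0 < 1 - β by linarith)
  have t2 : Filter.Tendsto (fun b : ℝ => (1 - β) * b ^ β) Filter.atTop Filter.atTop :=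
    (tendsto_rpow_atTop hβ).const_mul_atTop (by linarith)
  -- The bound m/8 makes the slope at b at most m/2 and the numerator of c at most bm/8 + |i|, so c
  -- ≤ b/4 + 2|i|/m; the last condition on b then yields c + 2 ≤ b. The second condition gives c ≥ a
  -- + 2.
  obtain ⟨b, h1, h2, h3, h4⟩ := ((t1.eventually_le_const (show 0 < m / 8 by linarith)).and
    ((t2.eventually_ge_atTop (i + m * (a + 2))).and ((Filter.eventually_ge_atTop B).and
      (Filter.eventually_ge_atTop (4 * (1 + |i| / m)))))).exists
  have hb : 0 < b := lt_of_lt_of_le (by positivity) h4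
  have hbb : b ^ β = b * b ^ (β - 1) := by
    rw [Real.rpow_sub_one hb.ne']; field_simp
  have hp := Real.rpow_pos_of_pos hb (β - 1)
  have hμ0 : 0 < powSlope β b := powSlope_pos hβ hb
  have hμ : powSlope β b ≤ m / 2 := by unfold powSlope; nlinarith
  have hd : 0 < m - powSlope β b := by linarith
  refine ⟨b, ((1 - β) * b ^ β - i) / (m - powSlope β b), h3, ?_, ?_, by linarith, ?_⟩
  · rw [le_div_iff₀ hd]
    nlinarith
  · have hnum : (1 - β) * b ^ β - i ≤ b * (m / 8) + |i| := by
      have : b ^ β ≤ b * (m / 8) := by rw [hbb]; exact mul_le_mul_of_nonneg_left h1 hb.le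
      have h0 : 0 < b ^ β := Real.rpow_pos_of_pos hb β
      have := neg_abs_le i
      nlinarith
    have hi' : |i| = |i| / m * m := by field_simp
    have hq : 0 ≤ |i| / m := by positivity
    have : ((1 - β) * b ^ β - i) / (m - powSlope β b) ≤ b / 4 + 2 * (|i| / m) := by
      rw [div_le_iff₀ hd]
      have : (b / 4 + 2 * (|i| / m)) * (m / 2) ≤
          (b / 4 + 2 * (|i| / m)) * (m - powSlope β b) :=
        mul_le_mul_of_nonneg_left (by linarith) (by positivity)
      nlinarith
    linarith
  · have hs : powSlope β b * b = β * b ^ β := by unfold powSlope; rw [hbb]; ring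
    have e1 : powTangent α a (((1 - β) * b ^ β - i) / (m - powSlope β b)) =
        i + m * (((1 - β) * b ^ β - i) / (m - powSlope β b)) := by
      simp only [powTangent, hi]; ring
    have e2 : powTangent β b (((1 - β) * b ^ β - i) / (m - powSlope β b)) =
        (1 - β) * b ^ β + powSlope β b * (((1 - β) * b ^ β - i) / (m - powSlope β b)) := by
      simp only [powTangent]; linarith
    rw [e1, e2]
    field_simp
    ring

/-- The corners of a concave function following the powers `t ^ e (k + 1)` on `[b k, a (k + 1)]`:
the tangent lines at `a k` and at `b k` meet at `c k`. -/
structure IsBendSequence (e a b c : ℕ → ℝ) : Prop where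
  start : a 0 = 1
  b_large : ∀ k, (a k + 1) ^ 2 + 2 ≤ b k
  a_large : ∀ k, (b k + 1) ^ 2 + 2 ≤ a (k + 1)
  a_le_c : ∀ k, a k + 2 ≤ c k
  c_le_b : ∀ k, c k + 2 ≤ b k
  slope_le : ∀ k, powSlope (e (k + 1)) (b k) ≤ powSlope (e k) (a k)
  crossing : ∀ k, powTangent (e k) (a k) (c k) = powTangent (e (k + 1)) (b k) (c k)

lemma exists_isBendSequence {e : ℕ → ℝ} (he0 : ∀ k, 0 < e k) (he1 : ∀ k, e (k + 1) < 1) :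
    ∃ a b c, IsBendSequence e a b c := by
  -- The guard 1 ≤ a sits inside the existential so that b and c can be chosen as total functions of
  -- a and iterated; that the iterates satisfy the guard is checked afterwards.
  have h : ∀ (k : ℕ) (a : ℝ), ∃ b c, 1 ≤ a → (a + 1) ^ 2 + 2 ≤ b ∧ a + 2 ≤ c ∧ c + 2 ≤ b ∧
      powSlope (e (k + 1)) b ≤ powSlope (e k) a ∧
      powTangent (e k) a c = powTangent (e (k + 1)) b c := fun k a => by
    by_cases ha : 1 ≤ a
    · obtain ⟨b, c, h⟩ := exists_powTangent_crossing (he0 k) (he0 (k + 1)) (he1 k) ha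
        ((a + 1) ^ 2 + 2)
      exact ⟨b, c, fun _ => h⟩
    · exact ⟨0, 0, fun h => absurd h ha⟩
  choose b c h using h
  let a : ℕ → ℝ := fun k => Nat.rec 1 (fun k x => (b k x + 1) ^ 2 + 2) k
  have ha : ∀ k, 1 ≤ a k := fun k => by
    cases k with
    | zero => exact le_rfl
    | succ k => show 1 ≤ (b k (a k) + 1) ^ 2 + 2; nlinarith [sq_nonneg (b k (a k) + 1)]
  exact ⟨a, fun k => b k (a k), fun k => c k (a k), rfl, fun k => (h k _ (ha k)).1,
    fun k => le_rfl, fun k => (h k _ (ha k)).2.1, fun k => (h k _ (ha k)).2.2.1,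
    fun k => (h k _ (ha k)).2.2.2.1, fun k => (h k _ (ha k)).2.2.2.2⟩

open SmoothCorner

/-- The `k`-th correction to the identity. -/
def bendTerm (e a b c : ℕ → ℝ) (k : ℕ) : ℝ → ℝ :=
  bend (fun t => t ^ e (k + 1)) (powSlope (e (k + 1)))
    (powSlope (e k) (a k) - powSlope (e (k + 1)) (b k)) (c k) (b k) (a (k + 1))

/-- The identity with the first `N` corrections. -/
def bendSum (e a b c : ℕ → ℝ) (N : ℕ) (t : ℝ) : ℝ :=
  t + ∑ k ∈ Finset.range N, bendTerm e a b c k t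

/-- The identity with all corrections. -/
def bendLimit (e a b c : ℕ → ℝ) (t : ℝ) : ℝ := bendSum e a b c ⌈t⌉₊ t

namespace IsBendSequence

variable {e a b c : ℕ → ℝ} (h : IsBendSequence e a b c)
include h

lemma add_one_le (k : ℕ) : (k : ℝ) + 1 ≤ a k := by
  induction k with
  | zero => simp [h.start]
  | succ k ih =>
    have h1 := h.b_large k
    have h2 := h.a_large k
    push_cast
    nlinarith

lemma b_le_a (k : ℕ) : b k + 2 ≤ a (k + 1) := by
  have h1 := h.b_large k
  have h2 := h.a_large k
  have := h.add_one_le k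
  nlinarith [sq_nonneg (a k + 1)]

lemma monotone_c : Monotone c := monotone_nat_of_le_succ fun k => by
  linarith [h.c_le_b k, h.b_le_a k, h.a_le_c (k + 1)]

lemma b_pos (k : ℕ) : 0 < b k := by nlinarith [h.b_large k, sq_nonneg (a k + 1)]

/-- Telescoping: past a k + 1 the partial sum is the tangent line at a k. The corner at c k lowers
its slope to that at b k, and `crossing` says that the resulting line is the tangent there. The rest
of the bend replaces this tangent by the power and then by the tangent at a (k + 1). -/
lemma bendSum_of_ge (h0 : e 0 = 1) (k : ℕ) {t : ℝ} (ht : a k + 1 ≤ t) :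
    bendSum e a b c k t = powTangent (e k) (a k) t := by
  induction k with
  | zero => simp [bendSum, powTangent, powSlope, h0]
  | succ k ih =>
    have h1 := h.b_le_a k
    have h2 := h.a_le_c k
    have h3 := h.c_le_b k
    have hs : bendSum e a b c (k + 1) t = bendSum e a b c k t + bendTerm e a b c k t := by
      simp [bendSum, Finset.sum_range_succ, add_assoc]
    have hx := h.crossing k
    rw [hs, ih (by linarith), bendTerm, bend_of_ge (by linarith) (by linarith) ht]
    simp only [powTangent] at hx ⊢
    linear_combination hx

lemma bendSum_succ_of_mem (h0 : e 0 = 1) (k : ℕ) {t : ℝ} (h1 : b k + 1 ≤ t)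
    (h2 : t ≤ a (k + 1) - 1) : bendSum e a b c (k + 1) t = t ^ e (k + 1) := by
  have h4 := h.a_le_c k
  have h3 := h.c_le_b k
  have hs : bendSum e a b c (k + 1) t = bendSum e a b c k t + bendTerm e a b c k t := by
    simp [bendSum, Finset.sum_range_succ, add_assoc]
  have hx := h.crossing k
  rw [hs, h.bendSum_of_ge h0 k (by linarith), bendTerm, bend_mid (by linarith) h1 h2]
  simp only [powTangent] at hx ⊢
  linear_combination hx

lemma bendSum_eq {M N : ℕ} (hMN : M ≤ N) {t : ℝ} (ht : t ≤ c M - 1) :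
    bendSum e a b c N t = bendSum e a b c M t := by
  unfold bendSum
  congr 1
  refine (Finset.sum_subset (Finset.range_mono hMN) fun k _ hk => ?_).symm
  have hk : M ≤ k := by simpa using hk
  have := h.monotone_c hk
  exact bend_of_le (by linarith [h.c_le_b k]) (by linarith [h.b_le_a k]) (by linarith)

/-- As c N ≥ N + 1, the corrections with index at least ⌈t⌉₊ vanish at t, so the truncation used in
`bendLimit` agrees with any partial sum valid at t. -/
lemma bendLimit_eq {N : ℕ} {t : ℝ} (ht : t ≤ c N - 1) :
    bendLimit e a b c t = bendSum e a b c N t := by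
  have h1 : t ≤ c ⌈t⌉₊ - 1 := by
    have := Nat.le_ceil t
    linarith [h.add_one_le ⌈t⌉₊, h.a_le_c ⌈t⌉₊]
  rcases le_total N ⌈t⌉₊ with h2 | h2
  · exact h.bendSum_eq h2 ht
  · exact (h.bendSum_eq h2 h1).symm

lemma le_c (N : ℕ) : (N : ℝ) ≤ c N - 1 := by linarith [h.add_one_le N, h.a_le_c N]

lemma hasDerivAt_pow (k : ℕ) : ∀ s ∈ Set.Icc (b k) (a (k + 1)),
    HasDerivAt (fun t : ℝ => t ^ e (k + 1)) (powSlope (e (k + 1)) s) s := fun s hs =>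
  hasDerivAt_pow_powSlope _ (by linarith [h.b_pos k, hs.1])

lemma contDiff_bendLimit : ContDiff ℝ ∞ (bendLimit e a b c) := by
  refine contDiff_iff_contDiffAt.2 fun t => ?_
  have hN : ContDiff ℝ ∞ (bendSum e a b c (⌈t⌉₊ + 1)) := by
    refine contDiff_id.add (ContDiff.sum fun k _ => contDiff_bend (by linarith [h.b_le_a k]) ?_)
    intro s hs
    exact Real.contDiffAt_rpow_const_of_ne (by linarith [h.b_pos k, hs.1])
  refine hN.contDiffAt.congr_of_eventuallyEq ?_
  have ht : t < ((⌈t⌉₊ + 1 : ℕ) : ℝ) := by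
    push_cast
    linarith [Nat.le_ceil t]
  filter_upwards [Iio_mem_nhds ht] with s hs
  exact h.bendLimit_eq (hs.le.trans (h.le_c _))

/-- Concavity involves only two points and their combination, all to the left of some c N - 1, where
the limit is a finite sum of concave functions. -/
lemma concaveOn_bendLimit (he0 : ∀ k, 0 < e k) (he1 : ∀ k, e (k + 1) < 1) :
    ConcaveOn ℝ Set.univ (bendLimit e a b c) := by
  refine ⟨convex_univ, fun x _ y _ p q hp hq hpq => ?_⟩
  obtain ⟨N, hN⟩ := exists_nat_ge (max x y)
  have hc := hN.trans (h.le_c N)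
  have hz : p • x + q • y ≤ c N - 1 := (Convex.combo_le_max x y hp hq hpq).trans hc
  rw [h.bendLimit_eq (t := x) ((le_max_left _ _).trans hc),
    h.bendLimit_eq (t := y) ((le_max_right _ _).trans hc), h.bendLimit_eq hz]
  have hs : ConcaveOn ℝ Set.univ (bendSum e a b c N) := by
    refine (concaveOn_id convex_univ).add ?_
    clear hN hc hz
    induction N with
    | zero => simpa using concaveOn_const (0 : ℝ) convex_univ
    | succ N ih =>
      simp only [Finset.sum_range_succ]
      exact ih.add (concaveOn_bend (by linarith [h.b_le_a N])
        (sub_nonneg.2 (h.slope_le N)) (h.hasDerivAt_pow N)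
        (powSlope_antitoneOn (he0 _).le (he1 N).le (h.b_pos N)))
  exact hs.2 (Set.mem_univ _) (Set.mem_univ _) hp hq hpq

lemma bendLimit_of_le {t : ℝ} (ht : t ≤ 1) : bendLimit e a b c t = t := by
  rw [h.bendLimit_eq (N := 0) (by linarith [h.add_one_le 0, h.a_le_c 0, h.start])]
  simp [bendSum]

lemma bendLimit_of_mem (h0 : e 0 = 1) (k : ℕ) {t : ℝ} (h1 : b k + 1 ≤ t)
    (h2 : t ≤ a (k + 1) - 1) : bendLimit e a b c t = t ^ e (k + 1) := by
  rw [h.bendLimit_eq (N := k + 1) (by linarith [h.a_le_c (k + 1)]),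
    h.bendSum_succ_of_mem h0 k h1 h2]

end IsBendSequence

/-! ### The alternating warping function -/

/-- A smooth concave function on the line which is the identity on `(-∞, 1]` and nonnegative
on `[0, ∞)`. -/
structure IsWarping (f : ℝ → ℝ) : Prop where
  contDiff : ContDiff ℝ ∞ f
  concave : ConcaveOn ℝ Set.univ f
  eq_self : ∀ t ≤ 1, f t = t
  nonneg : ∀ t, 0 ≤ t → 0 ≤ f t

/-- The exponents `1, 1/2, 1/2, 1/3, 2/3, 1/4, 3/4, …`. -/
def alternatingExponent : ℕ → ℝ
  | 0 => 1
  | k + 1 => if Even k then 1 / ((k / 2 : ℕ) + 2 : ℝ) else 1 - 1 / ((k / 2 : ℕ) + 2 : ℝ)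

lemma alternatingExponent_mem (k : ℕ) :
    0 < alternatingExponent (k + 1) ∧ alternatingExponent (k + 1) < 1 := by
  have h1 : (0 : ℝ) < 1 / ((k / 2 : ℕ) + 2 : ℝ) := by positivity
  have h2 : 1 / ((k / 2 : ℕ) + 2 : ℝ) < 1 := by
    rw [div_lt_one (by positivity)]
    have : (0 : ℝ) ≤ (k / 2 : ℕ) := Nat.cast_nonneg _
    linarith
  simp only [alternatingExponent]
  split_ifs <;> constructor <;> linarith

open RiemannianGeometry in
lemma exists_isAlternatingWarping :
    ∃ (f : ℝ → ℝ) (R : ℕ → ℝ), IsWarping f ∧ IsAlternatingWarping f R := by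
  have he0 : ∀ k, 0 < alternatingExponent k := fun k => by
    cases k with
    | zero => exact one_pos
    | succ k => exact (alternatingExponent_mem k).1
  have he1 := fun k => (alternatingExponent_mem k).2
  obtain ⟨a, b, c, h⟩ := exists_isBendSequence he0 he1
  set f := bendLimit alternatingExponent a b c
  have hcv := h.concaveOn_bendLimit he0 he1
  have hf0 : ∀ t, 0 ≤ t → 0 ≤ f t := fun t ht => by
    obtain ⟨k, hk⟩ := exists_nat_ge t
    have hab := h.b_le_a k
    have hb0 : 0 < b k + 1 := by linarith [h.b_pos k]
    have htb : t ≤ b k + 1 := by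
      linarith [h.add_one_le k, h.a_le_c k, h.c_le_b k]
    have hfb : 0 ≤ f (b k + 1) := by
      rw [show f _ = _ from h.bendLimit_of_mem rfl k le_rfl (by linarith)]
      exact Real.rpow_nonneg hb0.le _
    have hfz : f 0 = 0 := h.bendLimit_of_le zero_le_one
    -- The graph lies above the chord from the origin to the point over b k + 1, where f is a power
    -- and hence nonnegative.
    have := hcv.2 (Set.mem_univ 0) (Set.mem_univ (b k + 1))
      (sub_nonneg.2 ((div_le_one hb0).2 htb)) (div_nonneg ht hb0.le) (by ring)
    simp only [smul_eq_mul, mul_zero, zero_add] at this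
    rw [div_mul_cancel₀ _ hb0.ne'] at this
    refine le_trans ?_ this
    rw [show bendLimit alternatingExponent a b c 0 = 0 from hfz]
    have := mul_nonneg (div_nonneg ht hb0.le) hfb
    simpa using this
  -- The radii interleave as a 0, b 0, a 1, b 1, …. Thus R (4l-3), R (4l-2) are b (2l-2), a (2l-1),
  -- with exponent number 2l-1, and R (4l-1), R (4l) are b (2l-1), a (2l), with exponent number 2l.
  refine ⟨f, fun j => if Even j then a (j / 2) else b (j / 2),
    ⟨h.contDiff_bendLimit, hcv, fun t => h.bendLimit_of_le, hf0⟩,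
    h.contDiff_bendLimit.contDiffOn, hcv.subset (Set.subset_univ _) (convex_Ici 0), hf0,
    fun t ht => h.bendLimit_of_le ht.2, by simp [h.start], fun j => ?_, ?_, ?_⟩
  · rcases Nat.even_or_odd' j with ⟨k, rfl | rfl⟩
    · have : (2 * k + 1) / 2 = k := by omega
      simp [this]
      linarith [h.b_large k]
    · have : (2 * k + 1) / 2 = k := by omega
      have h2 : (2 * k + 1 + 1) / 2 = k + 1 := by omega
      have h3 : Even (2 * k + 1 + 1) := ⟨k + 1, by ring⟩
      simp [this, h2, h3]
      linarith [h.a_large k]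
  · intro l hl t ht
    obtain ⟨m, rfl⟩ : ∃ m, l = m + 1 := ⟨l - 1, by omega⟩
    have o1 : ¬ Even (4 * (m + 1) - 3) := by rw [Nat.not_even_iff]; omega
    have o2 : Even (4 * (m + 1) - 2) := by rw [Nat.even_iff]; omega
    simp only [o1, o2, if_true, if_false, show (4 * (m + 1) - 3) / 2 = 2 * m by omega,
      show (4 * (m + 1) - 2) / 2 = 2 * m + 1 by omega] at ht
    rw [show f t = _ from h.bendLimit_of_mem rfl (2 * m) ht.1 ht.2]
    simp [alternatingExponent]
    congr 2
    ring
  · intro l hl t ht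
    obtain ⟨m, rfl⟩ : ∃ m, l = m + 1 := ⟨l - 1, by omega⟩
    have o1 : ¬ Even (4 * (m + 1) - 1) := by rw [Nat.not_even_iff]; omega
    have o2 : Even (4 * (m + 1)) := by rw [Nat.even_iff]; omega
    simp only [o1, o2, if_true, if_false, show (4 * (m + 1) - 1) / 2 = 2 * m + 1 by omega,
      show (4 * (m + 1)) / 2 = 2 * m + 1 + 1 by omega] at ht
    rw [show f t = _ from h.bendLimit_of_mem rfl (2 * m + 1) ht.1 ht.2]
    simp [alternatingExponent, show (2 * m + 1) / 2 = m by omega]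
    congr 3
    ring

namespace IsWarping

variable {f : ℝ → ℝ} (hf : IsWarping f)
include hf

/-- A concave function that decreases once keeps decreasing at least linearly, and so cannot stay
nonnegative. -/
lemma monotone : Monotone f := by
  refine monotone_iff_forall_lt.2 fun x y hxy => ?_
  by_contra! hlt
  rcases le_or_gt y 1 with hy | hy
  · rw [hf.eq_self y hy, hf.eq_self x (by linarith)] at hlt
    linarith
  have hfy := hf.nonneg y (by linarith)
  -- At y + d the line through the points over x and y has fallen to height -1.
  set d := (f y + 1) * (y - x) / (f x - f y) with hd
  have hd0 : 0 < d := div_pos (mul_pos (by linarith) (by linarith)) (by linarith)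
  have := hf.concave.slope_anti_adjacent (Set.mem_univ x) (Set.mem_univ (y + d)) hxy
    (show y < y + d by linarith)
  rw [add_sub_cancel_left, div_le_div_iff₀ hd0 (by linarith)] at this
  have h2 : (f y - f x) * d = -(f y + 1) * (y - x) := by
    rw [hd]
    field_simp [show f x - f y ≠ 0 by linarith]
    ring
  rw [h2] at this
  have := le_of_mul_le_mul_right this (by linarith)
  linarith [hf.nonneg (y + d) (by linarith)]

lemma differentiable : Differentiable ℝ f := hf.contDiff.differentiable (by simp)

lemma contDiff_deriv : ContDiff ℝ ∞ (deriv f) := (contDiff_infty_iff_deriv.1 hf.contDiff).2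

lemma antitone_deriv : Antitone (deriv f) := by
  have := hf.concave.antitoneOn_deriv fun x _ => hf.differentiable x
  simpa using this

lemma deriv_nonneg (t : ℝ) : 0 ≤ deriv f t := hf.monotone.deriv_nonneg

lemma deriv_zero : deriv f 0 = 1 := by
  have : f =ᶠ[𝓝 0] id := by
    filter_upwards [Iio_mem_nhds (show (0 : ℝ) < 1 by norm_num)] with t ht using hf.eq_self t ht.le
  rw [this.deriv_eq, deriv_id]

lemma deriv_le_one {t : ℝ} (ht : 0 ≤ t) : deriv f t ≤ 1 := by
  rw [← hf.deriv_zero]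
  exact hf.antitone_deriv ht

lemma deriv_deriv_nonpos (t : ℝ) : deriv (deriv f) t ≤ 0 := hf.antitone_deriv.deriv_nonpos

lemma zero : f 0 = 0 := hf.eq_self 0 zero_le_one

/-- The quotient `f t / t` is nonincreasing. -/
lemma mul_le_mul {s t : ℝ} (hs : 0 ≤ s) (hst : s ≤ t) : s * f t ≤ t * f s := by
  rcases (hs.trans hst).eq_or_lt with h | ht
  · simp [← h, le_antisymm (hst.trans h.ge) hs]
  have := hf.concave.2 (Set.mem_univ 0) (Set.mem_univ t)
    (sub_nonneg.2 ((div_le_one ht).2 hst)) (div_nonneg hs ht.le) (by ring)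
  simp only [smul_eq_mul, mul_zero, zero_add, hf.zero] at this
  rw [div_mul_cancel₀ _ ht.ne', div_mul_eq_mul_div, div_le_iff₀ ht] at this
  linarith

lemma le_self (t : ℝ) : f t ≤ t := by
  rcases le_total t 1 with h | h
  · exact (hf.eq_self t h).le
  · have := hf.mul_le_mul zero_le_one h
    rw [hf.eq_self 1 le_rfl] at this
    linarith

lemma pos {t : ℝ} (ht : 0 < t) : 0 < f t := by
  have h := hf.monotone (min_le_left t 1)
  rw [hf.eq_self _ (min_le_right t 1)] at h
  exact (lt_min ht one_pos).trans_le h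

lemma one_le {t : ℝ} (ht : 1 ≤ t) : 1 ≤ f t := by
  have h := hf.monotone ht
  rwa [hf.eq_self 1 le_rfl] at h

end IsWarping

/-! ### The metric in Cartesian coordinates -/

/-- In the metric `A(|x|²) ⟨v, w⟩ + B(|x|²) ⟨x, v⟩ ⟨x, w⟩` which is `dt² + f(t)² ds²` in polar
coordinates, this is the function `B`. -/
def radialCoeff (f : ℝ → ℝ) (s : ℝ) : ℝ := if s < 1 then 0 else (s - f √s ^ 2) / s ^ 2

/-- In the metric `A(|x|²) ⟨v, w⟩ + B(|x|²) ⟨x, v⟩ ⟨x, w⟩` which is `dt² + f(t)² ds²` in polar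
coordinates, this is the function `A`. -/
def conformalCoeff (f : ℝ → ℝ) (s : ℝ) : ℝ := 1 - s * radialCoeff f s

namespace IsWarping

variable {f : ℝ → ℝ} (hf : IsWarping f)
include hf

lemma radialCoeff_eq {s : ℝ} (hs : 0 < s) : radialCoeff f s = (s - f √s ^ 2) / s ^ 2 := by
  unfold radialCoeff
  split_ifs with h
  · rw [hf.eq_self _ (Real.sqrt_le_one.2 h.le), Real.sq_sqrt hs.le]
    simp
  · rfl

omit hf in
lemma _root_.radialCoeff_of_lt {s : ℝ} (hs : s < 1) : radialCoeff f s = 0 := if_pos hs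

omit hf in
lemma _root_.conformalCoeff_of_lt {s : ℝ} (hs : s < 1) : conformalCoeff f s = 1 := by
  simp [conformalCoeff, radialCoeff_of_lt hs]

lemma conformalCoeff_eq {s : ℝ} (hs : 0 < s) : conformalCoeff f s = f √s ^ 2 / s := by
  rw [conformalCoeff, hf.radialCoeff_eq hs]
  field_simp
  ring

lemma radialCoeff_nonneg (s : ℝ) : 0 ≤ radialCoeff f s := by
  unfold radialCoeff
  split_ifs with h
  · rfl
  · have h0 : 0 ≤ s := by linarith
    have h1 := hf.le_self √s
    have h2 := hf.nonneg _ (Real.sqrt_nonneg s)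
    have : f √s ^ 2 ≤ √s ^ 2 := by gcongr
    rw [Real.sq_sqrt h0] at this
    exact div_nonneg (by linarith) (by positivity)

lemma conformalCoeff_pos (s : ℝ) : 0 < conformalCoeff f s := by
  rcases lt_or_ge s 1 with h | h
  · simp [conformalCoeff_of_lt h]
  · have h0 : 0 < s := by linarith
    rw [hf.conformalCoeff_eq h0]
    have := hf.pos (Real.sqrt_pos.2 h0)
    positivity

/-- The closed formula is smooth for s > 0, and B vanishes for s < 1 because f(t) = t up to 1; the
two open ranges cover the line, so the origin causes no trouble. -/
lemma contDiff_radialCoeff : ContDiff ℝ ∞ (radialCoeff f) := by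
  refine contDiff_iff_contDiffAt.2 fun s => ?_
  rcases lt_or_ge s 1 with h | h
  · refine (contDiffAt_const (c := (0 : ℝ))).congr_of_eventuallyEq ?_
    filter_upwards [Iio_mem_nhds h] with t ht using radialCoeff_of_lt ht
  · have h0 : 0 < s := by linarith
    have hr : ContDiffAt ℝ ∞ (fun s => (s - f √s ^ 2) / s ^ 2) s := by
      have h1 : ContDiffAt ℝ ∞ (fun s => f √s) s :=
        ContDiffAt.comp s hf.contDiff.contDiffAt (Real.contDiffAt_sqrt h0.ne')
      exact (contDiffAt_id.sub (h1.pow 2)).div (contDiffAt_id.pow 2) (by positivity)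
    refine hr.congr_of_eventuallyEq ?_
    filter_upwards [Ioi_mem_nhds h0] with t ht using hf.radialCoeff_eq ht

lemma contDiff_conformalCoeff : ContDiff ℝ ∞ (conformalCoeff f) :=
  contDiff_const.sub (contDiff_id.mul hf.contDiff_radialCoeff)

end IsWarping

/-- The Euclidean inner product as a bilinear form. -/
def euclideanForm (n : ℕ) :
    EuclideanSpace ℝ (Fin n) →L[ℝ] EuclideanSpace ℝ (Fin n) →L[ℝ] ℝ := innerSL ℝ

lemma euclideanForm_apply {n : ℕ} (v w : EuclideanSpace ℝ (Fin n)) :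
    euclideanForm n v w = inner ℝ v w := rfl

/-- The bilinear form `A(|x|²) ⟨v, w⟩ + B(|x|²) ⟨x, v⟩ ⟨x, w⟩`. -/
def radialForm {n : ℕ} (f : ℝ → ℝ) (x : EuclideanSpace ℝ (Fin n)) :
    EuclideanSpace ℝ (Fin n) →L[ℝ] EuclideanSpace ℝ (Fin n) →L[ℝ] ℝ :=
  conformalCoeff f (‖x‖ ^ 2) • euclideanForm n +
    radialCoeff f (‖x‖ ^ 2) • (euclideanForm n x).smulRight (euclideanForm n x)

lemma radialForm_apply {n : ℕ} (f : ℝ → ℝ) (x v w : EuclideanSpace ℝ (Fin n)) :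
    radialForm f x v w = conformalCoeff f (‖x‖ ^ 2) * inner ℝ v w +
      radialCoeff f (‖x‖ ^ 2) * (inner ℝ x v * inner ℝ x w) := by
  simp [radialForm, euclideanForm_apply]

lemma radialForm_self_ge {n : ℕ} {f : ℝ → ℝ} (hf : IsWarping f)
    (x v : EuclideanSpace ℝ (Fin n)) :
    conformalCoeff f (‖x‖ ^ 2) * ‖v‖ ^ 2 ≤ radialForm f x v v := by
  rw [radialForm_apply, real_inner_self_eq_norm_sq]
  have := mul_nonneg (hf.radialCoeff_nonneg (‖x‖ ^ 2)) (mul_self_nonneg (inner ℝ x v))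
  linarith

lemma contDiff_radialForm {n : ℕ} {f : ℝ → ℝ} (hf : IsWarping f) :
    ContDiff ℝ ∞ (radialForm (n := n) f) := by
  have h1 : ContDiff ℝ ∞ fun x : EuclideanSpace ℝ (Fin n) => ‖x‖ ^ 2 := contDiff_norm_sq ℝ
  rw [contDiff_clm_apply_iff]
  intro v
  rw [contDiff_clm_apply_iff]
  intro w
  simp only [radialForm_apply]
  have hA := hf.contDiff_conformalCoeff.comp h1
  have hB := hf.contDiff_radialCoeff.comp h1
  exact (hA.mul contDiff_const).add (hB.mul ((contDiff_id.inner ℝ contDiff_const).mul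
    (contDiff_id.inner ℝ contDiff_const)))

/-- A field of bilinear forms on a vector space, seen as acting on the tangent spaces. -/
def tangentForm {n : ℕ}
    (φ : EuclideanSpace ℝ (Fin n) →
      EuclideanSpace ℝ (Fin n) →L[ℝ] EuclideanSpace ℝ (Fin n) →L[ℝ] ℝ)
    (x : EuclideanSpace ℝ (Fin n)) :
    TangentSpace (𝓡 n) x →L[ℝ] TangentSpace (𝓡 n) x →L[ℝ] ℝ := φ x

/-- The tangent bundle of the model space is trivialised by the identity, so in coordinates the
section is φ itself. -/
lemma contMDiff_tangentForm {n : ℕ}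
    {φ : EuclideanSpace ℝ (Fin n) →
      EuclideanSpace ℝ (Fin n) →L[ℝ] EuclideanSpace ℝ (Fin n) →L[ℝ] ℝ}
    (hφ : ContDiff ℝ ∞ φ) :
    ContMDiff (𝓡 n) ((𝓡 n).prod
      𝓘(ℝ, EuclideanSpace ℝ (Fin n) →L[ℝ] EuclideanSpace ℝ (Fin n) →L[ℝ] ℝ)) ∞
      (fun x => Bundle.TotalSpace.mk'
        (EuclideanSpace ℝ (Fin n) →L[ℝ] EuclideanSpace ℝ (Fin n) →L[ℝ] ℝ) x
        (tangentForm φ x)) := by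
  intro x
  rw [Bundle.contMDiffAt_section]
  convert! hφ.contMDiff.contMDiffAt (x := x)
  ext v w
  rename_i y
  rw [hom_trivializationAt_apply]
  refine (inCoordinates_apply_eq₂
    (F₁ := EuclideanSpace ℝ (Fin n)) (F₂ := EuclideanSpace ℝ (Fin n)) (F₃ := ℝ)
    (E₁ := fun x : EuclideanSpace ℝ (Fin n) => TangentSpace (𝓡 n) x)
    (E₂ := fun x : EuclideanSpace ℝ (Fin n) => TangentSpace (𝓡 n) x)
    (E₃ := fun _ : EuclideanSpace ℝ (Fin n) => ℝ) (x₀ := x) (x := y) ?_ ?_ ?_).trans ?_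
  · exact Set.mem_univ y
  · exact Set.mem_univ y
  · trivial
  · have h1 : ∀ v : EuclideanSpace ℝ (Fin n), (trivializationAt (EuclideanSpace ℝ (Fin n))
        (fun x : EuclideanSpace ℝ (Fin n) => TangentSpace (𝓡 n) x) x).symm y v = v := fun v =>
      (Bundle.Trivialization.symmL_apply (R := ℝ) _ (Set.mem_univ y) v).symm.trans
        (DFunLike.congr_fun (TangentBundle.symmL_model_space (𝕜 := ℝ) x y) v)
    rw [h1 v, h1 w]
    exact DFunLike.congr_fun (Bundle.Trivial.linearMapAt_trivialization ℝ _ ℝ y) (φ y v w)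

/-- The Riemannian metric on `ℝⁿ` which is `dt² + f(t)² ds²` in polar coordinates. -/
def warpedMetric (n : ℕ) {f : ℝ → ℝ} (hf : IsWarping f) :
    RiemannianGeometry.Metric n (EuclideanSpace ℝ (Fin n)) where
  inner := tangentForm (radialForm f)
  symm x (v : EuclideanSpace ℝ (Fin n)) (w : EuclideanSpace ℝ (Fin n)) := by
    show radialForm f x v w = radialForm f x w v
    rw [radialForm_apply, radialForm_apply, real_inner_comm,
      mul_comm (inner ℝ x v : ℝ) (inner ℝ x w)]
  pos x (v : EuclideanSpace ℝ (Fin n)) hv := by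
    refine lt_of_lt_of_le ?_ (radialForm_self_ge hf x v)
    exact mul_pos (hf.conformalCoeff_pos _) (pow_pos (norm_pos_iff.2 hv) 2)
  isVonNBounded x := by
    change Bornology.IsVonNBounded ℝ {v : EuclideanSpace ℝ (Fin n) | radialForm f x v v < 1}
    refine (NormedSpace.isVonNBounded_closedBall ℝ (EuclideanSpace ℝ (Fin n))
      (√(1 / conformalCoeff f (‖x‖ ^ 2)))).subset fun v hv => ?_
    have hv : radialForm f x v v < 1 := hv
    rw [mem_closedBall_zero_iff]
    refine Real.le_sqrt_of_sq_le ?_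
    rw [le_div_iff₀ (hf.conformalCoeff_pos _)]
    linarith [radialForm_self_ge hf x v]
  contMDiff := contMDiff_tangentForm (contDiff_radialForm hf)

lemma warpedMetric_inner {n : ℕ} {f : ℝ → ℝ} (hf : IsWarping f)
    (x v w : EuclideanSpace ℝ (Fin n)) :
    (warpedMetric n hf).inner x v w = conformalCoeff f (‖x‖ ^ 2) * inner ℝ v w +
      radialCoeff f (‖x‖ ^ 2) * (inner ℝ x v * inner ℝ x w) :=
  radialForm_apply f x v w

/-! ### Comparison with the Euclidean distance, completeness -/

namespace RiemannianGeometry.Metric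

section PathLength

open scoped Bundle

variable {n : ℕ} {M : Type*} [TopologicalSpace M]
  [ChartedSpace (EuclideanSpace ℝ (Fin n)) M] [IsManifold (𝓡 n) ∞ M] (g : Metric n M)

/-- The length of the velocity of a path. -/
def speed (γ : ℝ → M) (t : ℝ) : ℝ≥0∞ :=
  ENNReal.ofReal √(g.inner (γ t) (mfderiv 𝓘(ℝ, ℝ) (𝓡 n) γ t (1 : ℝ))
    (mfderiv 𝓘(ℝ, ℝ) (𝓡 n) γ t (1 : ℝ)))

lemma pathELength_eq_lintegral_speed (γ : ℝ → M) (a b : ℝ) :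
    letI : Bundle.RiemannianBundle (fun x : M => TangentSpace (𝓡 n) x) := ⟨g.toRiemannianMetric⟩
    Manifold.pathELength (𝓡 n) γ a b = ∫⁻ t in Set.Icc a b, g.speed γ t := by
  let : Bundle.RiemannianBundle (fun x : M => TangentSpace (𝓡 n) x) := ⟨g.toRiemannianMetric⟩
  rw [Manifold.pathELength]
  refine MeasureTheory.lintegral_congr fun t => ?_
  rw [← ofReal_norm, norm_eq_sqrt_real_inner]
  rfl

lemma riemDist_le_lintegral_speed {γ : ℝ → M} (hγ : ContMDiff 𝓘(ℝ, ℝ) (𝓡 n) 1 γ) :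
    g.riemDist (γ 0) (γ 1) ≤ ∫⁻ t in Set.Icc 0 1, g.speed γ t := by
  let : Bundle.RiemannianBundle (fun x : M => TangentSpace (𝓡 n) x) := ⟨g.toRiemannianMetric⟩
  rw [← g.pathELength_eq_lintegral_speed]
  exact Manifold.riemannianEDist_le_pathELength hγ.contMDiffOn rfl rfl zero_le_one

lemma exists_path_of_riemDist_lt {p q : M} {r : ℝ≥0∞} (h : g.riemDist p q < r) :
    ∃ γ : ℝ → M, γ 0 = p ∧ γ 1 = q ∧ ContMDiff 𝓘(ℝ, ℝ) (𝓡 n) 1 γ ∧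
      ∫⁻ t in Set.Icc 0 1, g.speed γ t < r := by
  let : Bundle.RiemannianBundle (fun x : M => TangentSpace (𝓡 n) x) := ⟨g.toRiemannianMetric⟩
  obtain ⟨γ, h0, h1, hγ, hl, -⟩ :=
    Manifold.exists_lt_locally_constant_of_riemannianEDist_lt h zero_lt_one
  exact ⟨γ, h0, h1, hγ, by rwa [← g.pathELength_eq_lintegral_speed]⟩

lemma riemDist_triangle (p q r : M) : g.riemDist p r ≤ g.riemDist p q + g.riemDist q r := by
  let : Bundle.RiemannianBundle (fun x : M => TangentSpace (𝓡 n) x) := ⟨g.toRiemannianMetric⟩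
  exact Manifold.riemannianEDist_triangle

end PathLength

section VectorSpace

variable {n : ℕ} (g : Metric n (EuclideanSpace ℝ (Fin n)))

/-- The squared length of a tangent vector of a vector space. -/
def normSq (x v : EuclideanSpace ℝ (Fin n)) : ℝ := g.inner x v v

lemma speed_eq (γ : ℝ → EuclideanSpace ℝ (Fin n)) (t : ℝ) :
    g.speed γ t = ENNReal.ofReal √(g.normSq (γ t) (deriv γ t)) := by
  have : mfderiv 𝓘(ℝ, ℝ) (𝓡 n) γ t (1 : ℝ) = deriv γ t :=
    DFunLike.congr_fun mfderiv_eq_fderiv (1 : ℝ)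
  unfold speed normSq
  rw [this]

lemma riemDist_le_edist
    (hg : ∀ x v : EuclideanSpace ℝ (Fin n), √(g.normSq x v) ≤ ‖v‖)
    (p q : EuclideanSpace ℝ (Fin n)) : g.riemDist p q ≤ edist p q := by
  have hγ : ContDiff ℝ 1 (fun t : ℝ => p + t • (q - p)) := by fun_prop
  have h := g.riemDist_le_lintegral_speed hγ.contMDiff
  simp only [zero_smul, add_zero, one_smul, add_sub_cancel] at h
  refine h.trans ?_
  have hd : ∀ t, deriv (fun t : ℝ => p + t • (q - p)) t = q - p := fun t => by
    simpa using (((hasDerivAt_id t).smul_const (q - p)).const_add p).deriv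
  calc ∫⁻ t in Set.Icc 0 1, g.speed (fun t : ℝ => p + t • (q - p)) t
      ≤ ∫⁻ _ in Set.Icc (0 : ℝ) 1, edist p q := by
        refine MeasureTheory.lintegral_mono fun t => ?_
        rw [speed_eq, hd, edist_dist, dist_comm, dist_eq_norm]
        exact ENNReal.ofReal_le_ofReal (hg _ _)
    _ = edist p q := by simp

/-- Along any path the variation of ρ is at most the integral of |dρ(γ')|, hence at most the length.
-/
lemma abs_sub_le_riemDist {ρ : EuclideanSpace ℝ (Fin n) → ℝ} (hρ : ContDiff ℝ 1 ρ)
    (hg : ∀ x v : EuclideanSpace ℝ (Fin n), |fderiv ℝ ρ x v| ≤ √(g.normSq x v))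
    (p q : EuclideanSpace ℝ (Fin n)) : ENNReal.ofReal |ρ p - ρ q| ≤ g.riemDist p q := by
  refine le_of_forall_gt fun r hr => ?_
  obtain ⟨γ, h0, h1, hγ, hl⟩ := g.exists_path_of_riemDist_lt hr
  refine lt_of_le_of_lt ?_ hl
  have hγ' : ContDiff ℝ 1 γ := hγ.contDiff
  have hc : ContDiff ℝ 1 (ρ ∘ γ) := hρ.comp hγ'
  have := enorm_sub_le_lintegral_derivWithin_Icc_of_contDiffOn_Icc hc.contDiffOn
    (zero_le_one (α := ℝ))
  simp only [Function.comp_apply, h0, h1] at this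
  rw [abs_sub_comm, ← Real.norm_eq_abs, ofReal_norm]
  refine this.trans (MeasureTheory.setLIntegral_mono' measurableSet_Icc fun t ht => ?_)
  have hd : HasDerivAt (ρ ∘ γ) (fderiv ℝ ρ (γ t) (deriv γ t)) t :=
    (hρ.differentiable one_ne_zero (γ t)).hasFDerivAt.comp_hasDerivAt t
      (hγ'.differentiable one_ne_zero t).hasDerivAt
  rw [hd.hasDerivWithinAt.derivWithin (uniqueDiffOn_Icc zero_lt_one t ht), speed_eq,
    ← ofReal_norm, Real.norm_eq_abs]
  exact ENNReal.ofReal_le_ofReal (hg _ _)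

end VectorSpace

end RiemannianGeometry.Metric

open RiemannianGeometry

section warpedMetric

variable {n : ℕ} {f : ℝ → ℝ} (hf : IsWarping f)

lemma warpedMetric_normSq (x v : EuclideanSpace ℝ (Fin n)) :
    (warpedMetric n hf).normSq x v = conformalCoeff f (‖x‖ ^ 2) * inner ℝ v v +
      radialCoeff f (‖x‖ ^ 2) * (inner ℝ x v * inner ℝ x v) :=
  radialForm_apply f x v v

/-- Cauchy–Schwarz together with A + |x|² B = 1 and B ≥ 0; the latter is the inequality f(t) ≤ t. -/
lemma warpedMetric_normSq_le (x v : EuclideanSpace ℝ (Fin n)) :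
    (warpedMetric n hf).normSq x v ≤ ‖v‖ ^ 2 := by
  rw [warpedMetric_normSq, real_inner_self_eq_norm_sq, conformalCoeff]
  have h : inner ℝ x v * inner ℝ x v ≤ ‖x‖ ^ 2 * ‖v‖ ^ 2 := by
    have := abs_real_inner_le_norm x v
    rw [← abs_mul_abs_self, ← mul_pow, sq]
    exact mul_self_le_mul_self (abs_nonneg _) this
  nlinarith [mul_le_mul_of_nonneg_left h (hf.radialCoeff_nonneg (‖x‖ ^ 2))]

/-- This says that the radius has gradient of length at most 1. Split ⟨x, v⟩² by A + |x|² B = 1 and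
apply Cauchy–Schwarz to the A-part only. -/
lemma sq_inner_le_warpedMetric_normSq (x v : EuclideanSpace ℝ (Fin n)) :
    inner ℝ x v ^ 2 ≤ ‖x‖ ^ 2 * (warpedMetric n hf).normSq x v := by
  rw [warpedMetric_normSq, real_inner_self_eq_norm_sq]
  have h : inner ℝ x v ^ 2 ≤ ‖x‖ ^ 2 * ‖v‖ ^ 2 := by
    have := abs_real_inner_le_norm x v
    rw [← sq_abs, ← mul_pow]
    exact pow_le_pow_left₀ (abs_nonneg _) this 2
  have h2 := mul_le_mul_of_nonneg_left h (hf.conformalCoeff_pos (‖x‖ ^ 2)).le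
  have h3 : conformalCoeff f (‖x‖ ^ 2) = 1 - ‖x‖ ^ 2 * radialCoeff f (‖x‖ ^ 2) := rfl
  have h4 : inner ℝ x v ^ 2 = conformalCoeff f (‖x‖ ^ 2) * inner ℝ x v ^ 2 +
    ‖x‖ ^ 2 * radialCoeff f (‖x‖ ^ 2) * inner ℝ x v ^ 2 := by rw [h3]; ring
  nlinarith

lemma warpedMetric_riemDist_le (p q : EuclideanSpace ℝ (Fin n)) :
    (warpedMetric n hf).riemDist p q ≤ edist p q :=
  Metric.riemDist_le_edist _ (fun x v =>
    (Real.sqrt_le_sqrt (warpedMetric_normSq_le hf x v)).trans_eq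
      (Real.sqrt_sq (norm_nonneg v))) p q

lemma abs_norm_sub_norm_le_warpedMetric_riemDist (p q : EuclideanSpace ℝ (Fin n)) :
    ENNReal.ofReal |‖p‖ - ‖q‖| ≤ (warpedMetric n hf).riemDist p q := by
  -- The norm is not differentiable at the origin, so it is replaced by √(ε + ‖x‖²), still with
  -- gradient of length at most 1, and ε tends to 0.
  have key : ∀ ε : ℝ, 0 < ε →
      ENNReal.ofReal |√(ε + ‖p‖ ^ 2) - √(ε + ‖q‖ ^ 2)| ≤ (warpedMetric n hf).riemDist p q := by
    intro ε hε
    have h0 : ∀ x : EuclideanSpace ℝ (Fin n), 0 < ε + ‖x‖ ^ 2 := fun x => by positivity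
    refine Metric.abs_sub_le_riemDist (warpedMetric n hf)
      (ρ := fun x => √(ε + ‖x‖ ^ 2)) ?_ ?_ p q
    · exact (contDiff_const.add (contDiff_norm_sq ℝ)).sqrt fun x => (h0 x).ne'
    · intro x v
      have hd := (((hasStrictFDerivAt_norm_sq x).hasFDerivAt.const_add ε).sqrt (h0 x).ne').fderiv
      rw [hd]
      refine Real.le_sqrt_of_sq_le ?_
      have h1 := sq_inner_le_warpedMetric_normSq hf x v
      have h2 := Real.sq_sqrt (h0 x).le
      have h3 := Real.sqrt_pos.2 (h0 x)
      have h4 : 0 ≤ (warpedMetric n hf).normSq x v := by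
        have := radialForm_self_ge hf x v
        exact le_trans (mul_nonneg (hf.conformalCoeff_pos _).le (sq_nonneg _)) this
      have e : ((1 / (2 * √(ε + ‖x‖ ^ 2))) • (2 • (innerSL ℝ) x) : _ →L[ℝ] ℝ) v =
          inner ℝ x v / √(ε + ‖x‖ ^ 2) := by
        simp
        field_simp
      rw [sq_abs, e, div_pow, h2, div_le_iff₀ (h0 x)]
      nlinarith
  have hc : Filter.Tendsto (fun ε : ℝ => ENNReal.ofReal |√(ε + ‖p‖ ^ 2) - √(ε + ‖q‖ ^ 2)|)
      (𝓝[>] 0) (𝓝 (ENNReal.ofReal |‖p‖ - ‖q‖|)) := by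
    have : Continuous fun ε : ℝ => ENNReal.ofReal |√(ε + ‖p‖ ^ 2) - √(ε + ‖q‖ ^ 2)| :=
      ENNReal.continuous_ofReal.comp (by fun_prop)
    have h := this.tendsto 0
    simp only [zero_add, Real.sqrt_sq (norm_nonneg _)] at h
    exact h.mono_left nhdsWithin_le_nhds
  exact le_of_tendsto hc (eventually_mem_nhdsWithin.mono key)

lemma ball_subset_warpedMetric_ball (p : EuclideanSpace ℝ (Fin n)) (R : ℝ) :
    _root_.Metric.ball 0 (R - ‖p‖) ⊆ (warpedMetric n hf).ball p R := by
  intro q hq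
  rw [mem_ball_zero_iff] at hq
  refine lt_of_le_of_lt (((warpedMetric n hf).riemDist_triangle p 0 q).trans
    (add_le_add (warpedMetric_riemDist_le hf p 0) (warpedMetric_riemDist_le hf 0 q))) ?_
  rw [edist_dist, edist_dist, dist_zero_right, dist_zero_left,
    ← ENNReal.ofReal_add (norm_nonneg _) (norm_nonneg _)]
  exact (ENNReal.ofReal_lt_ofReal_iff (by linarith [norm_nonneg p, norm_nonneg q])).2
    (by linarith)

lemma warpedMetric_ball_subset_ball (p : EuclideanSpace ℝ (Fin n)) (R : ℝ) :
    (warpedMetric n hf).ball p R ⊆ _root_.Metric.ball 0 (R + ‖p‖) := by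
  intro q hq
  have h := (abs_norm_sub_norm_le_warpedMetric_riemDist hf p q).trans_lt hq
  have := (ENNReal.ofReal_lt_ofReal_iff_of_nonneg (abs_nonneg _)).1 h
  rw [mem_ball_zero_iff]
  linarith [neg_abs_le (‖p‖ - ‖q‖)]

/-- A Cauchy sequence has bounded norms, hence a Euclidean-convergent subsequence; this also
converges for the smaller Riemannian distance, and carries the whole sequence along. -/
lemma warpedMetric_isComplete : (warpedMetric n hf).IsComplete := by
  intro u hu
  obtain ⟨N, hN⟩ := hu 1 one_pos
  have hb : ∀ i, u (N + i) ∈ _root_.Metric.closedBall (0 : EuclideanSpace ℝ (Fin n))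
      (‖u N‖ + 1) := fun i => by
    have h := (abs_norm_sub_norm_le_warpedMetric_riemDist hf _ _).trans_lt
      (hN (N + i) N (by omega) le_rfl)
    rw [← ENNReal.ofReal_one, ENNReal.ofReal_lt_ofReal_iff_of_nonneg (abs_nonneg _)] at h
    rw [mem_closedBall_zero_iff]
    linarith [le_abs_self (‖u (N + i)‖ - ‖u N‖)]
  obtain ⟨p, -, φ, hφ, hp⟩ := (isCompact_closedBall _ _).tendsto_subseq hb
  refine ⟨p, ENNReal.tendsto_nhds_zero.2 fun ε hε => ?_⟩
  obtain ⟨K, hK⟩ := hu (ε / 2) (ENNReal.half_pos hε.ne')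
  have h2 := (tendsto_iff_edist_tendsto_0.1 hp).eventually_lt_const (ENNReal.half_pos hε.ne')
  obtain ⟨j, hj, hjK⟩ := (h2.and (Filter.eventually_ge_atTop K)).exists
  filter_upwards [Filter.eventually_ge_atTop K] with i hi
  have hKj : K ≤ N + φ j := by have := hφ.id_le j; simp only [id] at this; omega
  calc (warpedMetric n hf).riemDist (u i) p
      ≤ (warpedMetric n hf).riemDist (u i) (u (N + φ j)) +
        (warpedMetric n hf).riemDist (u (N + φ j)) p := Metric.riemDist_triangle _ _ _ _
    _ ≤ ε / 2 + ε / 2 := add_le_add (hK _ _ hi hKj).le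
        ((warpedMetric_riemDist_le hf _ _).trans hj.le)
    _ = ε := ENNReal.add_halves ε

lemma warpedMetric_isOpenManifold (hn : 0 < n) : (warpedMetric n hf).IsOpenManifold := by
  have : Nonempty (Fin n) := ⟨⟨0, hn⟩⟩
  exact ⟨inferInstance, inferInstance, inferInstance, NormedSpace.noncompactSpace ℝ _,
    warpedMetric_isComplete hf⟩

lemma warpedMetric_isRotationallySymmetric :
    (warpedMetric n hf).IsRotationallySymmetric f := by
  intro t θ ht hθ a b ξ η hξ hη
  have hs : ‖t • θ‖ ^ 2 = t ^ 2 := by rw [norm_smul, hθ, mul_one, Real.norm_eq_abs, sq_abs]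
  have hθθ : (inner ℝ θ θ : ℝ) = 1 := by rw [real_inner_self_eq_norm_sq, hθ, one_pow]
  have hξ' : (inner ℝ ξ θ : ℝ) = 0 := by rw [real_inner_comm, hξ]
  have hA : t ^ 2 * conformalCoeff f (t ^ 2) = f t ^ 2 := by
    rw [hf.conformalCoeff_eq (by positivity), Real.sqrt_sq ht.le]
    field_simp
  have hB : conformalCoeff f (t ^ 2) = 1 - t ^ 2 * radialCoeff f (t ^ 2) := rfl
  rw [warpedMetric_inner, hs]
  simp only [inner_add_left, inner_add_right, real_inner_smul_left, real_inner_smul_right, hξ, hη,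
    hθθ, hξ']
  linear_combination (inner ℝ ξ η : ℝ) * hA + a * b * hB

end warpedMetric

/-! ### Volumes of balls -/

open RiemannianGeometry

namespace RiemannianGeometry.Metric

variable {n : ℕ} (g : Metric n (EuclideanSpace ℝ (Fin n)))

lemma coordField_eq (x y : EuclideanSpace ℝ (Fin n)) (i : Fin n) :
    coordField x y i = stdVec i :=
  DFunLike.congr_fun (mfderiv_id (I := 𝓡 n) (x := y)) (stdVec i)

lemma coeff_eq (x y : EuclideanSpace ℝ (Fin n)) (i j : Fin n) :
    g.coeff x y i j = g.inner y (stdVec i) (stdVec j) := by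
  have h : ∀ k, coordField x y k = stdVec k := coordField_eq x y
  simp only [coeff, Matrix.of_apply]
  rw [h i, h j]
  rfl

lemma coeff_eq_coeff (x x' y : EuclideanSpace ℝ (Fin n)) : g.coeff x y = g.coeff x' y := by
  ext i j
  rw [coeff_eq, coeff_eq]

lemma vol_eq : g.vol = MeasureTheory.volume.withDensity
    (fun y => ENNReal.ofReal √(g.coeff 0 y).det) := by
  have h : ∀ x, g.chartVolume x = MeasureTheory.volume.withDensity
      (fun y => ENNReal.ofReal √(g.coeff 0 y).det) := fun x => by
    simp only [g.coeff_eq_coeff 0 x]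
    refine Eq.trans MeasureTheory.Measure.map_id ?_
    congr 1
    exact MeasureTheory.Measure.restrict_univ
  simp only [vol, h, iSup_const]

end RiemannianGeometry.Metric

section Volume

variable {n : ℕ} {f : ℝ → ℝ} (hf : IsWarping f)

lemma warpedMetric_coeff (x y : EuclideanSpace ℝ (Fin n)) (i j : Fin n) :
    (warpedMetric n hf).coeff x y i j = conformalCoeff f (‖y‖ ^ 2) * (if i = j then 1 else 0) +
      radialCoeff f (‖y‖ ^ 2) * (y i * y j) := by
  rw [Metric.coeff_eq]
  refine (warpedMetric_inner hf y (Metric.stdVec i) (Metric.stdVec j)).trans ?_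
  simp [Metric.stdVec, EuclideanSpace.inner_single_right, eq_comm]

/-- Matrix determinant lemma for a rank-one perturbation of a scalar matrix. For the metric the last
factor is A + |y|² B = 1, so the density is √A^(n-1) = (f(t)/t)^(n-1). -/
lemma det_scalar_add_vecMulVec {m : ℕ} (a b : ℝ) (ha : a ≠ 0) (y : Fin (m + 1) → ℝ) :
    (Matrix.of fun i j => a * (if i = j then 1 else 0) + b * (y i * y j)).det =
      a ^ m * (a + b * ∑ i, y i ^ 2) := by
  have h : (Matrix.of fun i j => a * (if i = j then 1 else 0) + b * (y i * y j)) =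
      a • (1 + Matrix.replicateCol Unit (fun i => b / a * y i) * Matrix.replicateRow Unit y) := by
    ext i j
    simp [Matrix.one_apply, Matrix.mul_apply]
    field_simp
    simp
  rw [h, Matrix.det_smul, Matrix.det_one_add_replicateCol_mul_replicateRow, dotProduct,
    Fintype.card_fin]
  have e : ∑ i, y i * (b / a * y i) = b / a * ∑ i, y i ^ 2 := by
    rw [Finset.mul_sum]
    exact Finset.sum_congr rfl fun i _ => by ring
  rw [e]
  field_simp
  ring

lemma warpedMetric_det (x y : EuclideanSpace ℝ (Fin n)) (hn : 0 < n) :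
    ((warpedMetric n hf).coeff x y).det = conformalCoeff f (‖y‖ ^ 2) ^ (n - 1) := by
  obtain ⟨m, rfl⟩ : ∃ m, n = m + 1 := ⟨n - 1, by omega⟩
  have h : (warpedMetric (m + 1) hf).coeff x y = Matrix.of fun i j =>
      conformalCoeff f (‖y‖ ^ 2) * (if i = j then 1 else 0) +
      radialCoeff f (‖y‖ ^ 2) * (y i * y j) := by
    ext i j
    rw [warpedMetric_coeff, Matrix.of_apply]
  rw [h, det_scalar_add_vecMulVec _ _ (hf.conformalCoeff_pos _).ne',
    ← EuclideanSpace.real_norm_sq_eq, conformalCoeff]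
  ring_nf
  simp

lemma sqrt_conformalCoeff (hf : IsWarping f) {t : ℝ} (ht : 0 < t) :
    √(conformalCoeff f (t ^ 2)) = f t / t := by
  rw [hf.conformalCoeff_eq (by positivity), Real.sqrt_sq ht.le, ← div_pow,
    Real.sqrt_sq (div_nonneg (hf.nonneg t ht.le) ht.le)]

lemma warpedMetric_vol_apply (hn : 0 < n) {s : Set (EuclideanSpace ℝ (Fin n))}
    (hs : MeasurableSet s) : (warpedMetric n hf).vol s =
      ∫⁻ y in s, ENNReal.ofReal (√(conformalCoeff f (‖y‖ ^ 2)) ^ (n - 1)) := by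
  rw [Metric.vol_eq, MeasureTheory.withDensity_apply _ hs]
  refine MeasureTheory.lintegral_congr fun y => ?_
  rw [warpedMetric_det hf 0 y hn]
  congr 1
  rw [Real.sqrt_eq_iff_mul_self_eq (pow_nonneg (hf.conformalCoeff_pos _).le _)
    (pow_nonneg (Real.sqrt_nonneg _) _), ← mul_pow,
    Real.mul_self_sqrt (hf.conformalCoeff_pos _).le]

-- On the ball the density is at least (f(R)/R)^(n-1), because f(t)/t is nonincreasing.
open MeasureTheory in
lemma le_warpedMetric_vol_ball (hn : 0 < n) {R : ℝ} (hR : 0 < R) :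
    ENNReal.ofReal (volume.real (_root_.Metric.ball (0 : EuclideanSpace ℝ (Fin n)) 1) *
      (R * f R ^ (n - 1))) ≤ (warpedMetric n hf).vol (_root_.Metric.ball 0 R) := by
  have : Nonempty (Fin n) := ⟨⟨0, hn⟩⟩
  rw [warpedMetric_vol_apply hf hn measurableSet_ball]
  have h1 : ENNReal.ofReal ((f R / R) ^ (n - 1)) *
      volume (_root_.Metric.ball (0 : EuclideanSpace ℝ (Fin n)) R) =
      ENNReal.ofReal (volume.real (_root_.Metric.ball (0 : EuclideanSpace ℝ (Fin n)) 1) *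
      (R * f R ^ (n - 1))) := by
    rw [Measure.addHaar_ball _ _ hR.le, finrank_euclideanSpace_fin,
      ← ofReal_measureReal measure_ball_lt_top.ne,
      ← ENNReal.ofReal_mul (by positivity), ← ENNReal.ofReal_mul
      (pow_nonneg (div_nonneg (hf.nonneg R hR.le) hR.le) _)]
    congr 1
    obtain ⟨m, rfl⟩ : ∃ m, n = m + 1 := ⟨n - 1, by omega⟩
    simp only [Nat.add_sub_cancel, div_pow, pow_succ]
    field_simp
  rw [← h1, ← setLIntegral_const]
  refine setLIntegral_mono' measurableSet_ball fun y hy => ?_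
  rw [mem_ball_zero_iff] at hy
  refine ENNReal.ofReal_le_ofReal
    (pow_le_pow_left₀ (div_nonneg (hf.nonneg R hR.le) hR.le) ?_ _)
  rcases (norm_nonneg y).eq_or_lt with h0 | h0
  · rw [← h0, conformalCoeff_of_lt (by norm_num), Real.sqrt_one, div_le_one hR]
    exact hf.le_self R
  · rw [sqrt_conformalCoeff hf h0, div_le_div_iff₀ hR h0]
    linarith [hf.mul_le_mul h0.le hy.le]

-- In polar coordinates the integrand cancels the Jacobian t^(n-1), leaving the length R of the
-- radial interval.
open MeasureTheory in
lemma lintegral_ball_inv_norm_pow (hn : 0 < n) {R : ℝ} (hR : 0 < R) :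
    ∫⁻ y in _root_.Metric.ball (0 : EuclideanSpace ℝ (Fin n)) R,
      ENNReal.ofReal ((‖y‖ ^ (n - 1))⁻¹) = ENNReal.ofReal
      (n * volume.real (_root_.Metric.ball (0 : EuclideanSpace ℝ (Fin n)) 1) * R) := by
  have : Nonempty (Fin n) := ⟨⟨0, hn⟩⟩
  have hone : ∀ y ∈ Set.Ioo 0 R, y ^ (n - 1) • (y ^ (n - 1))⁻¹ = (1 : ℝ) := fun y hy => by
    have := hy.1
    simp [this.ne']
  have hint : IntegrableOn (fun y : EuclideanSpace ℝ (Fin n) => (‖y‖ ^ (n - 1))⁻¹)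
      (_root_.Metric.ball 0 R) := by
    rw [integrableOn_fun_norm_addHaar volume (f := fun t => (t ^ (n - 1))⁻¹),
      finrank_euclideanSpace_fin, integrableOn_congr_fun hone measurableSet_Ioo]
    simp
  rw [← ofReal_integral_eq_lintegral_ofReal hint (ae_of_all _ fun y => by positivity),
    ← integral_indicator measurableSet_ball]
  congr 1
  have h := integral_fun_norm_addHaar (volume : Measure (EuclideanSpace ℝ (Fin n)))
    ((Set.Iio R).indicator fun t => (t ^ (n - 1))⁻¹)
  have e : ∫ y in Set.Ioi (0 : ℝ), y ^ (n - 1) • (Set.Iio R).indicator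
      (fun t => (t ^ (n - 1))⁻¹) y = R := by
    have : ∀ y : ℝ, y ^ (n - 1) • (Set.Iio R).indicator (fun t => (t ^ (n - 1))⁻¹) y =
        (Set.Iio R).indicator (fun y => y ^ (n - 1) • (y ^ (n - 1))⁻¹) y := fun y => by
      by_cases hy : y < R <;> simp [hy]
    simp only [this]
    rw [setIntegral_indicator measurableSet_Iio, Set.Ioi_inter_Iio,
      setIntegral_congr_fun measurableSet_Ioo hone]
    simp [hR.le]
  rw [finrank_euclideanSpace_fin, e] at h
  rw [show n * volume.real (_root_.Metric.ball (0 : EuclideanSpace ℝ (Fin n)) 1) * R =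
    n • volume.real (_root_.Metric.ball (0 : EuclideanSpace ℝ (Fin n)) 1) • R by
    simp [mul_assoc], ← h]
  refine integral_congr_ae (ae_of_all _ fun y => ?_)
  by_cases hy : ‖y‖ < R <;> simp [hy]

-- Monotonicity of f bounds the density by f(R)^(n-1) ‖y‖^(-(n-1)) away from the origin, a null set.
open MeasureTheory in
lemma warpedMetric_vol_ball_le (hn : 0 < n) {R : ℝ} (hR : 0 < R) :
    (warpedMetric n hf).vol (_root_.Metric.ball 0 R) ≤
      ENNReal.ofReal (n * volume.real (_root_.Metric.ball (0 : EuclideanSpace ℝ (Fin n)) 1) *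
      (R * f R ^ (n - 1))) := by
  have : Nonempty (Fin n) := ⟨⟨0, hn⟩⟩
  rw [warpedMetric_vol_apply hf hn measurableSet_ball, ← mul_assoc,
    mul_comm _ (f R ^ (n - 1)), ENNReal.ofReal_mul (pow_nonneg (hf.nonneg R hR.le) _),
    ← lintegral_ball_inv_norm_pow hn hR, ← lintegral_const_mul' _ _ ENNReal.ofReal_ne_top]
  refine lintegral_mono_ae ?_
  have h0 : ∀ᵐ y : EuclideanSpace ℝ (Fin n), y ≠ 0 := by
    simp [ae_iff]
  filter_upwards [ae_restrict_of_ae h0, ae_restrict_mem measurableSet_ball] with y hy0 hy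
  rw [mem_ball_zero_iff] at hy
  have hy0 := norm_pos_iff.2 hy0
  rw [← ENNReal.ofReal_mul (pow_nonneg (hf.nonneg R hR.le) _), sqrt_conformalCoeff hf hy0,
    div_pow, div_eq_mul_inv]
  refine ENNReal.ofReal_le_ofReal (mul_le_mul_of_nonneg_right
    (pow_le_pow_left₀ (hf.nonneg _ hy0.le) (hf.monotone hy.le) _) (by positivity))

end Volume

/-! ### The two growth orders -/

open RiemannianGeometry Filter

lemma tendsto_log_add_div_log (c : ℝ) :
    Tendsto (fun R : ℝ => Real.log (R + c) / Real.log R) atTop (𝓝 1) := by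
  have h1 : Tendsto (fun R : ℝ => Real.log (1 + c / R)) atTop (𝓝 0) := by
    have h : Tendsto (fun R : ℝ => 1 + c / R) atTop (𝓝 1) := by
      simpa using (tendsto_id.const_div_atTop c).const_add (1 : ℝ)
    simpa [Function.comp_def] using ((Real.continuousAt_log one_ne_zero).tendsto.comp h)
  have h2 : Tendsto (fun R : ℝ => 1 + Real.log (1 + c / R) / Real.log R) atTop (𝓝 1) := by
    simpa using (h1.div_atTop Real.tendsto_log_atTop).const_add (1 : ℝ)
  refine h2.congr' ?_
  filter_upwards [eventually_gt_atTop 1, eventually_gt_atTop (-c)] with R hR hc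
  have hR0 : 0 < R := by linarith
  have hl := Real.log_pos hR
  have h3 : 0 < 1 + c / R := by
    rw [show 1 + c / R = (R + c) / R by field_simp]
    exact div_pos (by linarith) hR0
  rw [show R + c = R * (1 + c / R) by field_simp, Real.log_mul hR0.ne' h3.ne', add_div,
    div_self hl.ne']

lemma tendsto_const_add_mul_log_div_log (a c : ℝ) {ι : Type*} {l : Filter ι} {r k : ι → ℝ}
    {k₀ : ℝ} (hr : Tendsto r l atTop) (hk : Tendsto k l (𝓝 k₀)) :
    Tendsto (fun i => (((a + k i * Real.log (r i + c)) / Real.log (r i) : ℝ) : EReal)) l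
      (𝓝 (k₀ : EReal)) := by
  refine (continuous_coe_real_ereal.tendsto k₀).comp ?_
  have h1 : Tendsto (fun i => a / Real.log (r i)) l (𝓝 0) :=
    (Real.tendsto_log_atTop.comp hr).const_div_atTop a
  have h2 := h1.add (hk.mul ((tendsto_log_add_div_log c).comp hr))
  simp only [mul_one, zero_add] at h2
  refine h2.congr fun i => ?_
  simp only [Function.comp_apply]
  ring

/-- The growth exponent of a function squeezed between `A t f(t)ᵐ` at `t = R - d` and
`B t f(t)ᵐ` at `t = R + d`. -/
lemma liminf_limsup_order {f : ℝ → ℝ} {R : ℕ → ℝ} (hw : IsWarping f)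
    (hf : IsAlternatingWarping f R) {o : ℝ → EReal} {a b d m : ℝ} (hm : 0 ≤ m)
    (hlo : ∀ᶠ r in atTop, (((a + (Real.log (r - d) + m * Real.log (f (r - d)))) /
      Real.log r : ℝ) : EReal) ≤ o r)
    (hup : ∀ᶠ r in atTop, o r ≤ (((b + (Real.log (r + d) + m * Real.log (f (r + d)))) /
      Real.log r : ℝ) : EReal)) :
    liminf o atTop = 1 ∧ limsup o atTop = ((1 + m : ℝ) : EReal) := by
  have hR : ∀ j : ℕ, (j : ℝ) + 1 ≤ R j := fun j => by
    induction j with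
    | zero => simp [hf.start]
    | succ j ih =>
      have := hf.growth j
      push_cast
      nlinarith [Nat.cast_nonneg (α := ℝ) j]
  have hR2 : ∀ j : ℕ, R j + 2 ≤ R (j + 1) := fun j => by
    have := hf.growth j
    nlinarith [hR j, Nat.cast_nonneg (α := ℝ) j]
  have hRt : Tendsto R atTop atTop :=
    tendsto_atTop_mono hR (tendsto_atTop_add_const_right _ _ tendsto_natCast_atTop_atTop)
  have hl0 : Tendsto (fun l : ℕ => 1 / ((l : ℝ) + 1)) atTop (𝓝 0) :=
    tendsto_one_div_add_atTop_nhds_zero_nat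
  have key : ∀ (u : ℕ → ℕ) (c : ℝ), (∀ l, l ≤ u l) →
      Tendsto (fun l => R (u l) + c) atTop atTop := fun u c hu =>
    tendsto_atTop_add_const_right _ _ (hRt.comp (tendsto_atTop_mono hu tendsto_id))
  have e1 : ((1 : ℝ) : EReal) = 1 := rfl
  refine ⟨le_antisymm ?_ ?_, le_antisymm ?_ ?_⟩
  -- For the upper bound on the liminf, r is chosen so that r + d is the right end of the l-th slow
  -- interval; one point per interval suffices, with exponent 1 + m/(l+1).
  · have hr := key (fun l => 4 * l - 2) (-1 - d) (fun l => by omega)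
    have ht := tendsto_const_add_mul_log_div_log b d hr
      ((hl0.const_mul m).const_add 1)
    rw [mul_zero, add_zero, e1] at ht
    refine (hr.liminf_le_liminf_comp).trans (le_trans (liminf_le_liminf ?_) ht.liminf_eq.le)
    filter_upwards [hr.eventually hup, eventually_ge_atTop 1] with l hl hl1
    refine hl.trans (le_of_eq ?_)
    congr 2
    have hs := hR2 (4 * l - 3)
    rw [show 4 * l - 3 + 1 = 4 * l - 2 by omega] at hs
    have hpos : 0 < R (4 * l - 2) + (-1 - d) + d := by
      linarith [hR (4 * l - 3), Nat.cast_nonneg (α := ℝ) (4 * l - 3)]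
    rw [hf.slow l hl1 _ ⟨by linarith, by linarith⟩, Real.log_rpow hpos]
    ring
  -- Here f ≥ 1 beyond 1, so dropping the term m log f(r - d) only lowers the bound.
  · have ht := tendsto_const_add_mul_log_div_log a (-d) tendsto_id
      (tendsto_const_nhds (x := (1 : ℝ)))
    rw [← e1, ← ht.liminf_eq]
    refine liminf_le_liminf ?_
    filter_upwards [hlo, eventually_ge_atTop (1 + d), eventually_gt_atTop 1] with r hr hd h1
    refine le_trans ?_ hr
    have h2 := Real.log_nonneg (hw.one_le (t := r - d) (by linarith))
    rw [EReal.coe_le_coe_iff, id, ← sub_eq_add_neg, one_mul]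
    have := mul_nonneg hm h2
    exact div_le_div_of_nonneg_right (by linarith) (Real.log_pos h1).le
  -- Here f(t) ≤ t bounds the exponent by 1 + m.
  · have ht := tendsto_const_add_mul_log_div_log b d tendsto_id
      (tendsto_const_nhds (x := 1 + m))
    rw [← ht.limsup_eq]
    refine limsup_le_limsup ?_
    filter_upwards [hup, eventually_ge_atTop (1 - d), eventually_gt_atTop 1] with r hr hd h1
    refine hr.trans ?_
    have h2 := Real.log_le_log (hw.pos (t := r + d) (by linarith)) (hw.le_self (r + d))
    rw [EReal.coe_le_coe_iff, id]
    have := mul_le_mul_of_nonneg_left h2 hm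
    exact div_le_div_of_nonneg_right (by linarith) (Real.log_pos h1).le
  -- Now r - d is the right end of the l-th fast interval, with exponent 1 + m(1 - 1/(l+1)).
  · have hr := key (fun l => 4 * l) (-1 + d) (fun l => by omega)
    have ht := tendsto_const_add_mul_log_div_log a (-d) hr
      (((hl0.const_sub 1).const_mul m).const_add 1)
    rw [sub_zero, mul_one] at ht
    refine le_trans (le_trans ht.limsup_eq.ge (limsup_le_limsup ?_)) hr.limsup_comp_le_limsup
    filter_upwards [hr.eventually hlo, eventually_ge_atTop 1] with l hl hl1
    refine le_trans (le_of_eq ?_) hl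
    congr 2
    have hs := hR2 (4 * l - 1)
    rw [show 4 * l - 1 + 1 = 4 * l by omega] at hs
    have hpos : 0 < R (4 * l) + (-1 + d) - d := by
      linarith [hR (4 * l - 1), Nat.cast_nonneg (α := ℝ) (4 * l - 1)]
    rw [hf.fast l hl1 _ ⟨by linarith, by linarith⟩, Real.log_rpow hpos]
    ring_nf

open MeasureTheory in
lemma warpedMetric_IV_SV {n : ℕ} (hn : 0 < n) {f : ℝ → ℝ} {R : ℕ → ℝ} (hw : IsWarping f)
    (hf : IsAlternatingWarping f R) (p : EuclideanSpace ℝ (Fin n)) :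
    (warpedMetric n hw).IV p = 1 ∧ (warpedMetric n hw).SV p = n := by
  have hv : 0 < volume.real (_root_.Metric.ball (0 : EuclideanSpace ℝ (Fin n)) 1) :=
    ENNReal.toReal_pos
    (Metric.measure_ball_pos volume _ one_pos).ne' measure_ball_lt_top.ne
  set v₁ := volume.real (_root_.Metric.ball (0 : EuclideanSpace ℝ (Fin n)) 1)
  have hlog : ∀ C t : ℝ, 0 < C → 1 ≤ t → ENNReal.log (ENNReal.ofReal (C * (t * f t ^ (n - 1)))) =
      ((Real.log C + (Real.log t + (n - 1 : ℕ) * Real.log (f t)) : ℝ) : EReal) := by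
    intro C t hC ht
    have h1 : 0 < f t := hw.pos (by linarith)
    have h2 : 0 < f t ^ (n - 1) := pow_pos h1 _
    rw [ENNReal.log_ofReal_of_pos (by positivity), Real.log_mul hC.ne' (by positivity),
      Real.log_mul (by positivity) h2.ne', Real.log_pow]
  have hn' : (0 : ℝ) < n := by exact_mod_cast hn
  have := liminf_limsup_order hw hf (o := (warpedMetric n hw).volumeOrder p)
    (a := Real.log v₁) (b := Real.log (n * v₁)) (d := ‖p‖) (m := (n - 1 : ℕ)) (Nat.cast_nonneg _)
    ?_ ?_
  · refine ⟨this.1, this.2.trans ?_⟩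
    have : ((1 : ℝ) + (n - 1 : ℕ)) = n := by
      rw [Nat.cast_sub hn]
      simp
    rw [this]
    rfl
  · filter_upwards [eventually_ge_atTop (1 + ‖p‖), eventually_gt_atTop 1] with r hr h1
    rw [EReal.coe_div, ← hlog v₁ _ hv (by linarith)]
    refine EReal.div_le_div_right_of_nonneg (EReal.coe_nonneg.2 (Real.log_pos h1).le)
      (ENNReal.log_monotone ?_)
    exact (le_warpedMetric_vol_ball hw hn (by linarith)).trans
      (measure_mono (ball_subset_warpedMetric_ball hw p r))
  · filter_upwards [eventually_gt_atTop 1] with r h1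
    have := norm_nonneg p
    rw [EReal.coe_div, ← hlog (n * v₁) _ (by positivity) (by linarith)]
    refine EReal.div_le_div_right_of_nonneg (EReal.coe_nonneg.2 (Real.log_pos h1).le)
      (ENNReal.log_monotone ?_)
    exact (measure_mono (warpedMetric_ball_subset_ball hw p r)).trans
      (warpedMetric_vol_ball_le hw hn (by linarith))

/-! ### The curvature tensor of a radial metric -/

open RiemannianGeometry

/-- The function `F` is differentiable at `y` with `i`-th partial derivative `c`. -/
def HasPartialAt {n : ℕ} (F : EuclideanSpace ℝ (Fin n) → ℝ) (i : Fin n)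
    (y : EuclideanSpace ℝ (Fin n)) (c : ℝ) : Prop :=
  DifferentiableAt ℝ F y ∧ Metric.partialDeriv F i y = c

/-- The Kronecker symbol. -/
def kron {n : ℕ} (i j : Fin n) : ℝ := if i = j then 1 else 0

lemma kron_comm {n : ℕ} (i j : Fin n) : kron i j = kron j i := by
  simp only [kron, eq_comm]

lemma sum_kron_mul {n : ℕ} (i : Fin n) (w : Fin n → ℝ) : ∑ k, kron i k * w k = w i := by
  simp [kron]

namespace HasPartialAt

variable {n : ℕ} {F G : EuclideanSpace ℝ (Fin n) → ℝ} {i : Fin n}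
  {y : EuclideanSpace ℝ (Fin n)} {c d : ℝ}

lemma add (hF : HasPartialAt F i y c) (hG : HasPartialAt G i y d) :
    HasPartialAt (fun z => F z + G z) i y (c + d) := by
  refine ⟨hF.1.add hG.1, ?_⟩
  rw [← hF.2, ← hG.2]
  simp only [Metric.partialDeriv]
  rw [fderiv_fun_add hF.1 hG.1]
  rfl

lemma mul (hF : HasPartialAt F i y c) (hG : HasPartialAt G i y d) :
    HasPartialAt (fun z => F z * G z) i y (c * G y + F y * d) := by
  refine ⟨hF.1.mul hG.1, ?_⟩
  rw [← hF.2, ← hG.2]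
  simp only [Metric.partialDeriv]
  rw [fderiv_fun_mul hF.1 hG.1]
  simp
  ring

lemma const (a : ℝ) : HasPartialAt (fun _ : EuclideanSpace ℝ (Fin n) => a) i y 0 := by
  refine ⟨differentiableAt_const a, ?_⟩
  simp [Metric.partialDeriv]

lemma coord (j : Fin n) : HasPartialAt (fun z : EuclideanSpace ℝ (Fin n) => z j) i y (kron i j) := by
  have h : HasFDerivAt (fun z : EuclideanSpace ℝ (Fin n) => z j)
      (EuclideanSpace.proj j : EuclideanSpace ℝ (Fin n) →L[ℝ] ℝ) y :=
    (EuclideanSpace.proj j : EuclideanSpace ℝ (Fin n) →L[ℝ] ℝ).hasFDerivAt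
  refine ⟨h.differentiableAt, ?_⟩
  rw [Metric.partialDeriv, h.fderiv]
  simp [Metric.stdVec, kron, eq_comm]

lemma radial {φ : ℝ → ℝ} {φ' : ℝ} (h : HasDerivAt φ φ' (‖y‖ ^ 2)) :
    HasPartialAt (fun z => φ (‖z‖ ^ 2)) i y (2 * φ' * y i) := by
  have h2 := h.comp_hasFDerivAt y (hasStrictFDerivAt_norm_sq y).hasFDerivAt
  refine ⟨h2.differentiableAt, ?_⟩
  rw [Metric.partialDeriv]
  refine (DFunLike.congr_fun h2.fderiv _).trans ?_
  simp [Metric.stdVec, EuclideanSpace.inner_single_right]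
  ring

end HasPartialAt

/-- Differentiable coefficients `A`, `B` with `A + s B = 1` of a radial metric
`A(|x|²) ⟨v, w⟩ + B(|x|²) ⟨x, v⟩ ⟨x, w⟩`, with the first two derivatives at `s`. -/
structure RadialData where
  A : ℝ → ℝ
  B : ℝ → ℝ
  contDiff_A : ContDiff ℝ ∞ A
  contDiff_B : ContDiff ℝ ∞ B
  pos : ∀ s, 0 < A s
  add_mul : ∀ s, A s + s * B s = 1

namespace RadialData

variable (D : RadialData)

/-- The functions `P`, `Q`, `S` in the Christoffel symbols
`Γᵏ_ij = P (y_i δ_jk + y_j δ_ik) + y_k (Q δ_ij + S y_i y_j)`. -/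
def P (s : ℝ) : ℝ := deriv D.A s / D.A s
/-- See `RadialData.P`. -/
def Q (s : ℝ) : ℝ := D.B s - deriv D.A s
/-- See `RadialData.P`. -/
def S (s : ℝ) : ℝ := deriv D.B s - 2 * D.P s * D.B s

lemma hasDerivAt_A (s : ℝ) : HasDerivAt D.A (deriv D.A s) s :=
  (D.contDiff_A.differentiable (by simp) s).hasDerivAt

lemma hasDerivAt_B (s : ℝ) : HasDerivAt D.B (deriv D.B s) s :=
  (D.contDiff_B.differentiable (by simp) s).hasDerivAt

lemma hasDerivAt_deriv_A (s : ℝ) : HasDerivAt (deriv D.A) (deriv (deriv D.A) s) s :=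
  ((contDiff_infty_iff_deriv.1 D.contDiff_A).2.differentiable (by simp) s).hasDerivAt

lemma hasDerivAt_deriv_B (s : ℝ) : HasDerivAt (deriv D.B) (deriv (deriv D.B) s) s :=
  ((contDiff_infty_iff_deriv.1 D.contDiff_B).2.differentiable (by simp) s).hasDerivAt

lemma hasDerivAt_P (s : ℝ) : HasDerivAt D.P
    ((deriv (deriv D.A) s * D.A s - deriv D.A s * deriv D.A s) / D.A s ^ 2) s :=
  (D.hasDerivAt_deriv_A s).div (D.hasDerivAt_A s) (D.pos s).ne'

lemma hasDerivAt_Q (s : ℝ) : HasDerivAt D.Q (deriv D.B s - deriv (deriv D.A) s) s :=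
  (D.hasDerivAt_B s).sub (D.hasDerivAt_deriv_A s)

lemma hasDerivAt_S (s : ℝ) : HasDerivAt D.S (deriv D.S s) s := by
  have h := (D.hasDerivAt_deriv_B s).sub
    (((D.hasDerivAt_P s).const_mul 2).mul (D.hasDerivAt_B s))
  exact h.differentiableAt.hasDerivAt

/-- The coefficients of the curvature tensor
`R(u, v)w = α (⟨v,w⟩ u - ⟨u,w⟩ v) + β ⟨y,w⟩ (⟨y,v⟩ u - ⟨y,u⟩ v) + γ (⟨y,u⟩⟨v,w⟩ - ⟨y,v⟩⟨u,w⟩) y`. -/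
def α (s : ℝ) : ℝ := D.Q s - D.P s + s * D.P s * D.Q s
/-- See `RadialData.α`. -/
def β (s : ℝ) : ℝ := D.S s - 2 * deriv D.P s + D.P s ^ 2 + s * D.P s * D.S s
/-- See `RadialData.α`. -/
def γ (s : ℝ) : ℝ := 2 * deriv D.Q s - D.S s + D.Q s ^ 2 + s * D.S s * D.Q s

lemma deriv_add (s : ℝ) : deriv D.A s + (D.B s + s * deriv D.B s) = 0 := by
  have h : HasDerivAt (fun s => D.A s + s * D.B s) (deriv D.A s + (1 * D.B s + s * deriv D.B s)) s :=
    (D.hasDerivAt_A s).add ((hasDerivAt_id s).mul (D.hasDerivAt_B s))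
  have h2 : (fun s => D.A s + s * D.B s) = fun _ => 1 := funext D.add_mul
  rw [h2] at h
  simpa using h.unique (hasDerivAt_const s 1)

lemma deriv_deriv_add (s : ℝ) :
    deriv (deriv D.A) s + (2 * deriv D.B s + s * deriv (deriv D.B) s) = 0 := by
  have h := (D.hasDerivAt_deriv_A s).add ((D.hasDerivAt_B s).add
    ((hasDerivAt_id s).mul (D.hasDerivAt_deriv_B s)))
  have h2 : (deriv D.A + (D.B + id * deriv D.B)) = fun _ => 0 := funext D.deriv_add
  rw [h2] at h
  have := h.unique (hasDerivAt_const s 0)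
  simp only [id] at this
  linarith

/-- This is the skew-symmetry of g(R(u, v)w, z) in w and z, read off from the coefficients; it
eliminates γ from the sectional curvature. -/
lemma γ_add_mul_α (s : ℝ) : D.γ s + D.B s * D.α s = D.A s * D.β s := by
  have hA := (D.pos s).ne'
  have h0 : D.A s = 1 - s * D.B s := by linarith [D.add_mul s]
  have h1 : deriv D.A s = -(D.B s + s * deriv D.B s) := by linarith [D.deriv_add s]
  have h2 : deriv (deriv D.A) s = -(2 * deriv D.B s + s * deriv (deriv D.B) s) := by
    linarith [D.deriv_deriv_add s]
  rw [h0] at hA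
  simp only [γ, β, α, S, (D.hasDerivAt_P s).deriv, (D.hasDerivAt_Q s).deriv, P, Q]
  rw [h2, h1, h0]
  field_simp
  ring

/-- The Christoffel symbol `Γᵏ_ij` at `y`. -/
def Γ {n : ℕ} (k i j : Fin n) (y : EuclideanSpace ℝ (Fin n)) : ℝ :=
  D.P (‖y‖ ^ 2) * (y i * kron j k + y j * kron i k) +
    y k * (D.Q (‖y‖ ^ 2) * kron i j + D.S (‖y‖ ^ 2) * (y i * y j))

variable {n : ℕ} (g : Metric n (EuclideanSpace ℝ (Fin n)))

/-- The metric `g` has the coefficients given by `D`. -/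
def IsMetric : Prop := ∀ (x y : EuclideanSpace ℝ (Fin n)) (i j : Fin n),
  g.coeff x y i j = D.A (‖y‖ ^ 2) * kron i j + D.B (‖y‖ ^ 2) * (y i * y j)

variable {D g} (hg : D.IsMetric g)
include hg

/-- Sherman–Morrison, whose denominator is A + s B = 1. -/
lemma IsMetric.coeff_inv (x y : EuclideanSpace ℝ (Fin n)) (k l : Fin n) :
    (g.coeff x y)⁻¹ k l = (D.A (‖y‖ ^ 2))⁻¹ * (kron k l - D.B (‖y‖ ^ 2) * (y k * y l)) := by
  have h : (g.coeff x y)⁻¹ = Matrix.of fun k l =>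
      (D.A (‖y‖ ^ 2))⁻¹ * (kron k l - D.B (‖y‖ ^ 2) * (y k * y l)) := by
    refine Matrix.inv_eq_right_inv ?_
    ext i j
    have hA := (D.pos (‖y‖ ^ 2)).ne'
    have hs := D.add_mul (‖y‖ ^ 2)
    have h1 : ∑ k, kron i k * (kron k j - D.B (‖y‖ ^ 2) * (y k * y j)) =
        kron i j - D.B (‖y‖ ^ 2) * (y i * y j) :=
      sum_kron_mul i fun k => kron k j - D.B (‖y‖ ^ 2) * (y k * y j)
    have h2 : ∑ k, y k * (kron k j - D.B (‖y‖ ^ 2) * (y k * y j)) =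
        y j * (1 - D.B (‖y‖ ^ 2) * ‖y‖ ^ 2) := by
      have := sum_kron_mul j fun k => y k
      simp only [mul_sub, Finset.sum_sub_distrib]
      rw [EuclideanSpace.real_norm_sq_eq, mul_one, Finset.mul_sum, Finset.mul_sum]
      congr 1
      · rw [← this]
        exact Finset.sum_congr rfl fun k _ => by rw [kron_comm]; ring
      · exact Finset.sum_congr rfl fun k _ => by ring
    rw [Matrix.mul_apply]
    simp only [hg x y, Matrix.of_apply]
    have h3 : ∀ k, (D.A (‖y‖ ^ 2) * kron i k + D.B (‖y‖ ^ 2) * (y i * y k)) *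
        ((D.A (‖y‖ ^ 2))⁻¹ * (kron k j - D.B (‖y‖ ^ 2) * (y k * y j))) =
        kron i k * (kron k j - D.B (‖y‖ ^ 2) * (y k * y j)) + (D.A (‖y‖ ^ 2))⁻¹ *
        (D.B (‖y‖ ^ 2) * y i) * (y k * (kron k j - D.B (‖y‖ ^ 2) * (y k * y j))) := fun k => by
      field_simp
    simp only [h3, Finset.sum_add_distrib, ← Finset.mul_sum, h1, h2]
    rw [show 1 - D.B (‖y‖ ^ 2) * ‖y‖ ^ 2 = D.A (‖y‖ ^ 2) by linarith, Matrix.one_apply]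
    field_simp
    simp [kron]
  rw [h, Matrix.of_apply]

lemma IsMetric.partialDeriv_coeff (x y : EuclideanSpace ℝ (Fin n)) (m i j : Fin n) :
    Metric.partialDeriv (fun z => g.coeff x z i j) m y =
      2 * deriv D.A (‖y‖ ^ 2) * y m * kron i j + (2 * deriv D.B (‖y‖ ^ 2) * y m * (y i * y j) +
        D.B (‖y‖ ^ 2) * (kron m i * y j + y i * kron m j)) := by
  have h : (fun z => g.coeff x z i j) = fun z =>
      D.A (‖z‖ ^ 2) * kron i j + D.B (‖z‖ ^ 2) * (z i * z j) := funext fun z => hg x z i j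
  rw [h, (((HasPartialAt.radial (D.hasDerivAt_A _)).mul (.const (kron i j))).add
    ((HasPartialAt.radial (D.hasDerivAt_B _)).mul ((HasPartialAt.coord i).mul (.coord j)))).2]
  ring

lemma IsMetric.christoffel (x : EuclideanSpace ℝ (Fin n)) (k i j : Fin n) :
    g.christoffel x k i j = D.Γ k i j := by
  ext y
  have hA := (D.pos (‖y‖ ^ 2)).ne'
  have hs := D.add_mul (‖y‖ ^ 2)
  have hy : ∑ l, y l * y l = ‖y‖ ^ 2 := by
    rw [EuclideanSpace.real_norm_sq_eq]
    exact Finset.sum_congr rfl fun l _ => by ring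
  simp only [Metric.christoffel, hg.coeff_inv, hg.partialDeriv_coeff]
  set s := ‖y‖ ^ 2
  have e : ∀ l, (D.A s)⁻¹ * (kron k l - D.B s * (y k * y l)) *
      (2 * deriv D.A s * y i * kron j l + (2 * deriv D.B s * y i * (y j * y l) +
        D.B s * (kron i j * y l + y j * kron i l)) +
      (2 * deriv D.A s * y j * kron i l + (2 * deriv D.B s * y j * (y i * y l) +
        D.B s * (kron j i * y l + y i * kron j l))) -
      (2 * deriv D.A s * y l * kron i j + (2 * deriv D.B s * y l * (y i * y j) +
        D.B s * (kron l i * y j + y i * kron l j)))) =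
      2 * (D.A s)⁻¹ * (kron k l * (deriv D.A s * (y i * kron j l + y j * kron i l - y l * kron i j)
          + deriv D.B s * (y i * y j * y l) + D.B s * (kron i j * y l)))
      - 2 * (D.A s)⁻¹ * D.B s * y k * (deriv D.A s * y i * (kron j l * y l)
          + deriv D.A s * y j * (kron i l * y l)
          + (deriv D.B s * (y i * y j) + (D.B s - deriv D.A s) * kron i j) * (y l * y l)) :=
    fun l => by
      rw [kron_comm j i, kron_comm l i, kron_comm l j]
      ring
  simp only [e, Finset.sum_sub_distrib, Finset.sum_add_distrib, ← Finset.mul_sum]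
  rw [sum_kron_mul k fun l => deriv D.A s * (y i * kron j l + y j * kron i l - y l * kron i j)
    + deriv D.B s * (y i * y j * y l) + D.B s * (kron i j * y l),
    sum_kron_mul j fun l => y l, sum_kron_mul i fun l => y l, hy]
  simp only [Γ, P, Q, S]
  have h1 : deriv D.A s = -(D.B s + s * deriv D.B s) := by linarith [D.deriv_add s]
  have h0 : D.A s = 1 - s * D.B s := by linarith
  rw [h0] at hA
  rw [h1, h0]
  field_simp
  ring

omit hg in
lemma partialDeriv_Γ (y : EuclideanSpace ℝ (Fin n)) (m k i j : Fin n) :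
    Metric.partialDeriv (D.Γ k i j) m y =
      2 * deriv D.P (‖y‖ ^ 2) * y m * (y i * kron j k + y j * kron i k) +
      D.P (‖y‖ ^ 2) * (kron m i * kron j k + kron m j * kron i k) +
      kron m k * (D.Q (‖y‖ ^ 2) * kron i j + D.S (‖y‖ ^ 2) * (y i * y j)) +
      y k * (2 * deriv D.Q (‖y‖ ^ 2) * y m * kron i j +
        2 * deriv D.S (‖y‖ ^ 2) * y m * (y i * y j) +
        D.S (‖y‖ ^ 2) * (kron m i * y j + y i * kron m j)) := by
  have hP := (D.hasDerivAt_P (‖y‖ ^ 2)).differentiableAt.hasDerivAt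
  have hQ := (D.hasDerivAt_Q (‖y‖ ^ 2)).differentiableAt.hasDerivAt
  have h := ((HasPartialAt.radial (i := m) hP).mul
    (((HasPartialAt.coord i).mul (.const (kron j k))).add
      ((HasPartialAt.coord j).mul (.const (kron i k))))).add
    ((HasPartialAt.coord k).mul (((HasPartialAt.radial hQ).mul (.const (kron i j))).add
      ((HasPartialAt.radial (D.hasDerivAt_S _)).mul ((HasPartialAt.coord i).mul (.coord j)))))
  refine Eq.trans h.2 ?_
  ring

-- Contracting `Γ` with a Kronecker symbol relabels an index, and contracting it with y produces the
-- factor s = ‖y‖²; the first Christoffel symbol is a combination of these two kinds in m.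
omit hg in
lemma sum_Γ_mul_Γ (y : EuclideanSpace ℝ (Fin n)) (l k i j : Fin n) :
    ∑ m, D.Γ l i m y * D.Γ m j k y =
      D.P (‖y‖ ^ 2) * y i * D.Γ l j k y +
      y l * D.Q (‖y‖ ^ 2) * D.Γ i j k y +
      (D.P (‖y‖ ^ 2) * kron i l + y l * D.S (‖y‖ ^ 2) * y i) *
        (2 * D.P (‖y‖ ^ 2) * (y j * y k) +
          ‖y‖ ^ 2 * (D.Q (‖y‖ ^ 2) * kron j k + D.S (‖y‖ ^ 2) * (y j * y k))) := by
  have hy : ∑ l, y l * y l = ‖y‖ ^ 2 := by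
    rw [EuclideanSpace.real_norm_sq_eq]
    exact Finset.sum_congr rfl fun l _ => by ring
  have h1 : ∑ m, y m * D.Γ m j k y = 2 * D.P (‖y‖ ^ 2) * (y j * y k) +
      ‖y‖ ^ 2 * (D.Q (‖y‖ ^ 2) * kron j k + D.S (‖y‖ ^ 2) * (y j * y k)) := by
    have e : ∀ m, y m * D.Γ m j k y = D.P (‖y‖ ^ 2) * y j * (kron k m * y m) +
        D.P (‖y‖ ^ 2) * y k * (kron j m * y m) +
        (D.Q (‖y‖ ^ 2) * kron j k + D.S (‖y‖ ^ 2) * (y j * y k)) * (y m * y m) := fun m => by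
      simp only [Γ]
      ring
    simp only [e, Finset.sum_add_distrib, ← Finset.mul_sum]
    rw [sum_kron_mul k fun l => y l, sum_kron_mul j fun l => y l, hy]
    ring
  have e : ∀ m, D.Γ l i m y * D.Γ m j k y =
      D.P (‖y‖ ^ 2) * y i * (kron l m * D.Γ m j k y) +
      y l * D.Q (‖y‖ ^ 2) * (kron i m * D.Γ m j k y) +
      (D.P (‖y‖ ^ 2) * kron i l + y l * D.S (‖y‖ ^ 2) * y i) * (y m * D.Γ m j k y) := fun m => by
    conv_lhs => rw [Γ, kron_comm m l]
    ring
  simp only [e, Finset.sum_add_distrib, ← Finset.mul_sum]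
  rw [sum_kron_mul l fun m => D.Γ m j k y, sum_kron_mul i fun m => D.Γ m j k y, h1]

lemma IsMetric.riemannTensor (x y : EuclideanSpace ℝ (Fin n)) (l k i j : Fin n) :
    g.riemannTensor x l k i j y =
      D.α (‖y‖ ^ 2) * (kron j k * kron i l - kron i k * kron j l) +
      D.β (‖y‖ ^ 2) * y k * (y j * kron i l - y i * kron j l) +
      D.γ (‖y‖ ^ 2) * y l * (y i * kron j k - y j * kron i k) := by
  simp only [Metric.riemannTensor, hg.christoffel, partialDeriv_Γ, Finset.sum_sub_distrib,
    sum_Γ_mul_Γ]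
  simp only [Γ, α, β, γ]
  rw [kron_comm j i, kron_comm k l, kron_comm k i, kron_comm k j]
  ring

lemma IsMetric.innerAt (x : EuclideanSpace ℝ (Fin n)) (u v : Fin n → ℝ) :
    g.innerAt x u v = D.A (‖x‖ ^ 2) * (u ⬝ᵥ v) +
      D.B (‖x‖ ^ 2) * ((x.ofLp ⬝ᵥ u) * (x.ofLp ⬝ᵥ v)) := by
  have h : g.innerAt x u v = ∑ i, ∑ j, g.coeff x x i j * u i * v j := rfl
  rw [h]
  simp only [hg x x]
  have e : ∀ i, ∑ j, (D.A (‖x‖ ^ 2) * kron i j + D.B (‖x‖ ^ 2) * (x i * x j)) * u i * v j =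
      D.A (‖x‖ ^ 2) * (u i * v i) + D.B (‖x‖ ^ 2) * (x.ofLp ⬝ᵥ v) * (x i * u i) := fun i => by
    have e1 : ∀ j, (D.A (‖x‖ ^ 2) * kron i j + D.B (‖x‖ ^ 2) * (x i * x j)) * u i * v j =
        D.A (‖x‖ ^ 2) * u i * (kron i j * v j) + D.B (‖x‖ ^ 2) * (x i * u i) * (x j * v j) :=
      fun j => by ring
    simp only [e1, Finset.sum_add_distrib, ← Finset.mul_sum, sum_kron_mul]
    simp only [dotProduct]
    ring
  simp only [e, Finset.sum_add_distrib, ← Finset.mul_sum]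
  simp only [dotProduct]
  ring

lemma IsMetric.curvatureAt (x : EuclideanSpace ℝ (Fin n)) (u v w : Fin n → ℝ) :
    g.curvatureAt x u v w =
      D.α (‖x‖ ^ 2) • ((v ⬝ᵥ w) • u - (u ⬝ᵥ w) • v) +
      (D.β (‖x‖ ^ 2) * (x.ofLp ⬝ᵥ w)) • ((x.ofLp ⬝ᵥ v) • u - (x.ofLp ⬝ᵥ u) • v) +
      (D.γ (‖x‖ ^ 2) * ((x.ofLp ⬝ᵥ u) * (v ⬝ᵥ w) - (x.ofLp ⬝ᵥ v) * (u ⬝ᵥ w))) • x.ofLp := by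
  ext l
  have h : g.curvatureAt x u v w l =
      ∑ i, ∑ j, ∑ k, g.riemannTensor x l k i j x * u i * v j * w k := rfl
  rw [h]
  simp only [hg.riemannTensor]
  set s := ‖x‖ ^ 2
  have ek : ∀ i j, ∑ k, (D.α s * (kron j k * kron i l - kron i k * kron j l) +
      D.β s * x k * (x j * kron i l - x i * kron j l) +
      D.γ s * x l * (x i * kron j k - x j * kron i k)) * u i * v j * w k =
      (D.α s * (w j * kron i l - w i * kron j l) +
      D.β s * (x.ofLp ⬝ᵥ w) * (x j * kron i l - x i * kron j l) +
      D.γ s * x l * (x i * w j - x j * w i)) * u i * v j := fun i j => by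
    have e : ∀ k, (D.α s * (kron j k * kron i l - kron i k * kron j l) +
        D.β s * x k * (x j * kron i l - x i * kron j l) +
        D.γ s * x l * (x i * kron j k - x j * kron i k)) * u i * v j * w k =
        (D.α s * kron i l + D.γ s * x l * x i) * u i * v j * (kron j k * w k) -
        (D.α s * kron j l + D.γ s * x l * x j) * u i * v j * (kron i k * w k) +
        D.β s * (x j * kron i l - x i * kron j l) * u i * v j * (x k * w k) := fun k => by ring
    simp only [e, Finset.sum_add_distrib, Finset.sum_sub_distrib, ← Finset.mul_sum, sum_kron_mul]
    simp only [dotProduct]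
    ring
  simp only [ek]
  have ej : ∀ i, ∑ j, (D.α s * (w j * kron i l - w i * kron j l) +
      D.β s * (x.ofLp ⬝ᵥ w) * (x j * kron i l - x i * kron j l) +
      D.γ s * x l * (x i * w j - x j * w i)) * u i * v j =
      (D.α s * ((v ⬝ᵥ w) * kron i l - w i * v l) +
      D.β s * (x.ofLp ⬝ᵥ w) * ((x.ofLp ⬝ᵥ v) * kron i l - x i * v l) +
      D.γ s * x l * (x i * (v ⬝ᵥ w) - (x.ofLp ⬝ᵥ v) * w i)) * u i := fun i => by
    have e : ∀ j, (D.α s * (w j * kron i l - w i * kron j l) +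
        D.β s * (x.ofLp ⬝ᵥ w) * (x j * kron i l - x i * kron j l) +
        D.γ s * x l * (x i * w j - x j * w i)) * u i * v j =
        (D.α s * kron i l + D.γ s * x l * x i) * u i * (v j * w j) -
        (D.α s * w i + D.β s * (x.ofLp ⬝ᵥ w) * x i) * u i * (kron l j * v j) +
        (D.β s * (x.ofLp ⬝ᵥ w) * kron i l - D.γ s * x l * w i) * u i * (x j * v j) :=
      fun j => by rw [kron_comm j l]; ring
    simp only [e, Finset.sum_add_distrib, Finset.sum_sub_distrib, ← Finset.mul_sum, sum_kron_mul]
    simp only [dotProduct]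
    ring
  simp only [ej]
  have e : ∀ i, (D.α s * ((v ⬝ᵥ w) * kron i l - w i * v l) +
      D.β s * (x.ofLp ⬝ᵥ w) * ((x.ofLp ⬝ᵥ v) * kron i l - x i * v l) +
      D.γ s * x l * (x i * (v ⬝ᵥ w) - (x.ofLp ⬝ᵥ v) * w i)) * u i =
      (D.α s * (v ⬝ᵥ w) + D.β s * (x.ofLp ⬝ᵥ w) * (x.ofLp ⬝ᵥ v)) * (kron l i * u i) -
      (D.α s * v l + D.γ s * x l * (x.ofLp ⬝ᵥ v)) * (u i * w i) +
      (D.γ s * x l * (v ⬝ᵥ w) - D.β s * (x.ofLp ⬝ᵥ w) * v l) * (x i * u i) :=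
    fun i => by rw [kron_comm i l]; ring
  simp only [e, Finset.sum_add_distrib, Finset.sum_sub_distrib, ← Finset.mul_sum, sum_kron_mul]
  simp only [dotProduct, Pi.add_apply, Pi.sub_apply, Pi.smul_apply, smul_eq_mul]
  ring

end RadialData

/-! ### Nonnegativity of the sectional curvature -/

open RiemannianGeometry

lemma dotProduct_sq_le {n : ℕ} (u v : Fin n → ℝ) : (u ⬝ᵥ v) ^ 2 ≤ (u ⬝ᵥ u) * (v ⬝ᵥ v) := by
  have := Finset.sum_mul_sq_le_sq_mul_sq Finset.univ u v
  simpa only [dotProduct, sq] using this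

/-- Two minors of the Gram matrix of three vectors. -/
lemma gram_bounds {n : ℕ} (y u v : Fin n → ℝ) (hy : 0 < y ⬝ᵥ y) :
    0 ≤ (y ⬝ᵥ u) ^ 2 * (v ⬝ᵥ v) - 2 * (y ⬝ᵥ u) * (y ⬝ᵥ v) * (u ⬝ᵥ v) + (y ⬝ᵥ v) ^ 2 * (u ⬝ᵥ u) ∧
    (y ⬝ᵥ u) ^ 2 * (v ⬝ᵥ v) - 2 * (y ⬝ᵥ u) * (y ⬝ᵥ v) * (u ⬝ᵥ v) + (y ⬝ᵥ v) ^ 2 * (u ⬝ᵥ u) ≤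
      (y ⬝ᵥ y) * ((u ⬝ᵥ u) * (v ⬝ᵥ v) - (u ⬝ᵥ v) ^ 2) := by
  constructor
  · have h : 0 ≤ ((y ⬝ᵥ u) • v - (y ⬝ᵥ v) • u) ⬝ᵥ ((y ⬝ᵥ u) • v - (y ⬝ᵥ v) • u) :=
      Finset.sum_nonneg fun i _ => mul_self_nonneg _
    simp only [sub_dotProduct, dotProduct_sub, smul_dotProduct, dotProduct_smul, smul_eq_mul,
      dotProduct_comm v u] at h
    linarith
  -- Cauchy–Schwarz for the components of u and v orthogonal to y, scaled by y ⬝ᵥ y; the difference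
  -- of its two sides is (y ⬝ᵥ y)³ times the Gram determinant of y, u, v.
  · have h := dotProduct_sq_le ((y ⬝ᵥ y) • u - (y ⬝ᵥ u) • y) ((y ⬝ᵥ y) • v - (y ⬝ᵥ v) • y)
    simp only [sub_dotProduct, dotProduct_sub, smul_dotProduct, dotProduct_smul, smul_eq_mul,
      dotProduct_comm u y, dotProduct_comm v y] at h
    have h2 : 0 ≤ (y ⬝ᵥ y) ^ 3 * ((y ⬝ᵥ y) * ((u ⬝ᵥ u) * (v ⬝ᵥ v) - (u ⬝ᵥ v) ^ 2) -
        ((y ⬝ᵥ u) ^ 2 * (v ⬝ᵥ v) - 2 * (y ⬝ᵥ u) * (y ⬝ᵥ v) * (u ⬝ᵥ v) +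
          (y ⬝ᵥ v) ^ 2 * (u ⬝ᵥ u))) := by
      linarith
    have := nonneg_of_mul_nonneg_right h2 (pow_pos hy 3)
    linarith

namespace RadialData

variable {D : RadialData} {n : ℕ} {g : Metric n (EuclideanSpace ℝ (Fin n))}

lemma IsMetric.innerAt_curvatureAt (hg : D.IsMetric g) (x : EuclideanSpace ℝ (Fin n))
    (u v : Fin n → ℝ) : g.innerAt x (g.curvatureAt x u v v) u =
      D.A (‖x‖ ^ 2) * (D.α (‖x‖ ^ 2) * ((u ⬝ᵥ u) * (v ⬝ᵥ v) - (u ⬝ᵥ v) ^ 2) + D.β (‖x‖ ^ 2) *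
        ((x.ofLp ⬝ᵥ u) ^ 2 * (v ⬝ᵥ v) - 2 * (x.ofLp ⬝ᵥ u) * (x.ofLp ⬝ᵥ v) * (u ⬝ᵥ v) +
          (x.ofLp ⬝ᵥ v) ^ 2 * (u ⬝ᵥ u))) := by
  have hx : x.ofLp ⬝ᵥ x.ofLp = ‖x‖ ^ 2 := by
    rw [EuclideanSpace.real_norm_sq_eq]
    exact Finset.sum_congr rfl fun l _ => by ring
  have h1 := D.γ_add_mul_α (‖x‖ ^ 2)
  have h2 := D.add_mul (‖x‖ ^ 2)
  rw [hg.innerAt, hg.curvatureAt]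
  simp only [add_dotProduct, sub_dotProduct, dotProduct_add, dotProduct_sub, smul_dotProduct,
    dotProduct_smul, smul_eq_mul, dotProduct_comm v u, hx]
  linear_combination ((x.ofLp ⬝ᵥ u) ^ 2 * (v ⬝ᵥ v) -
    (x.ofLp ⬝ᵥ u) * (x.ofLp ⬝ᵥ v) * (u ⬝ᵥ v)) * (h1 + D.γ (‖x‖ ^ 2) * h2)

lemma IsMetric.nonnegSectionalCurvature (hg : D.IsMetric g) (hB : ∀ s, 0 ≤ s → 0 ≤ D.B s)
    (hα : ∀ s, 0 ≤ s → 0 ≤ D.α s) (hβ : ∀ s, 0 ≤ s → 0 ≤ D.α s + s * D.β s) :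
    g.NonnegSectionalCurvature := by
  intro x u v _
  have hs : 0 ≤ ‖x‖ ^ 2 := by positivity
  have hA := D.pos (‖x‖ ^ 2)
  have hW : 0 ≤ (u ⬝ᵥ u) * (v ⬝ᵥ v) - (u ⬝ᵥ v) ^ 2 := sub_nonneg.2 (dotProduct_sq_le u v)
  have hx : x.ofLp ⬝ᵥ x.ofLp = ‖x‖ ^ 2 := by
    rw [EuclideanSpace.real_norm_sq_eq]
    exact Finset.sum_congr rfl fun l _ => by ring
  have hN : 0 ≤ (x.ofLp ⬝ᵥ u) ^ 2 * (v ⬝ᵥ v) -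
      2 * (x.ofLp ⬝ᵥ u) * (x.ofLp ⬝ᵥ v) * (u ⬝ᵥ v) + (x.ofLp ⬝ᵥ v) ^ 2 * (u ⬝ᵥ u) ∧
      0 ≤ D.α (‖x‖ ^ 2) * ((u ⬝ᵥ u) * (v ⬝ᵥ v) - (u ⬝ᵥ v) ^ 2) + D.β (‖x‖ ^ 2) *
        ((x.ofLp ⬝ᵥ u) ^ 2 * (v ⬝ᵥ v) - 2 * (x.ofLp ⬝ᵥ u) * (x.ofLp ⬝ᵥ v) * (u ⬝ᵥ v) +
          (x.ofLp ⬝ᵥ v) ^ 2 * (u ⬝ᵥ u)) := by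
    rcases hs.eq_or_lt with h0 | h0
    · have hx0 : x.ofLp = 0 := by
        rw [← hx] at h0
        exact dotProduct_self_eq_zero.1 h0.symm
      simp only [hx0, zero_dotProduct]
      have := mul_nonneg (hα _ hs) hW
      constructor
      · simp
      · simpa using this
    · have h := gram_bounds x.ofLp u v (by rwa [hx])
      rw [hx] at h
      refine ⟨h.1, ?_⟩
      have h1 := mul_nonneg (hα _ hs) (sub_nonneg.2 h.2)
      have h2 := mul_nonneg (hβ _ hs) h.1
      -- With W the Gram determinant of u, v and N the form bounded in `gram_bounds`, s(αW + βN) =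
      -- α(sW - N) + (α + sβ)N and 0 ≤ N ≤ sW. The extremes N = 0 and N = sW are the tangential and
      -- the radial planes.
      refine nonneg_of_mul_nonneg_right (a := ‖x‖ ^ 2) ?_ h0
      linarith
  refine div_nonneg ?_ ?_
  · rw [hg.innerAt_curvatureAt]
    exact mul_nonneg hA.le hN.2
  · simp only [hg.innerAt]
    have h1 := mul_nonneg (mul_nonneg hA.le hA.le) hW
    have h2 := mul_nonneg (mul_nonneg hA.le (hB _ hs)) hN.1
    linarith

end RadialData

section

variable {f : ℝ → ℝ} (hf : IsWarping f)

/-- The coefficients of the metric `dt² + f(t)² ds²`. -/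
def IsWarping.radialData : RadialData where
  A := conformalCoeff f
  B := radialCoeff f
  contDiff_A := hf.contDiff_conformalCoeff
  contDiff_B := hf.contDiff_radialCoeff
  pos := hf.conformalCoeff_pos
  add_mul s := by simp [conformalCoeff]

lemma IsWarping.isMetric (n : ℕ) : hf.radialData.IsMetric (warpedMetric n hf) := fun x y i j =>
  warpedMetric_coeff hf x y i j

lemma IsWarping.hasDerivAt_comp_sqrt {φ : ℝ → ℝ} (hφ : Differentiable ℝ φ) {s : ℝ} (hs : 0 < s) :
    HasDerivAt (fun s => φ √s) (deriv φ √s / (2 * √s)) s := by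
  have := (hφ √s).hasDerivAt.comp s (Real.hasDerivAt_sqrt hs.ne')
  exact this.congr_deriv (by ring)

include hf

lemma IsWarping.deriv_conformalCoeff {s : ℝ} (hs : 0 < s) : deriv (conformalCoeff f) s =
    f √s * deriv f √s / (√s * s) - f √s ^ 2 / s ^ 2 := by
  have h1 : conformalCoeff f =ᶠ[𝓝 s] fun s => f √s ^ 2 / s := by
    filter_upwards [Ioi_mem_nhds hs] with r hr using hf.conformalCoeff_eq hr
  have h2 := ((IsWarping.hasDerivAt_comp_sqrt hf.differentiable hs).pow 2).div (hasDerivAt_id s)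
    hs.ne'
  rw [h1.deriv_eq]
  refine Eq.trans h2.deriv ?_
  have := Real.sqrt_pos.2 hs
  simp only [id]
  field_simp
  simp
  ring

lemma IsWarping.deriv_deriv_conformalCoeff {s : ℝ} (hs : 0 < s) :
    deriv (deriv (conformalCoeff f)) s =
      (deriv f √s ^ 2 + f √s * deriv (deriv f) √s) / (2 * s ^ 2) -
      5 * (f √s * deriv f √s) / (2 * √s * s ^ 2) + 2 * f √s ^ 2 / s ^ 3 := by
  have h1 : deriv (conformalCoeff f) =ᶠ[𝓝 s] fun s =>
      f √s * deriv f √s / (√s * s) - f √s ^ 2 / s ^ 2 := by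
    filter_upwards [Ioi_mem_nhds hs] with r hr using hf.deriv_conformalCoeff hr
  have hq := Real.sqrt_pos.2 hs
  have hqq := Real.sq_sqrt hs.le
  have hd := IsWarping.hasDerivAt_comp_sqrt hf.differentiable hs
  have hd2 := IsWarping.hasDerivAt_comp_sqrt (hf.contDiff_deriv.differentiable (by simp)) hs
  have h2 := ((hd.mul hd2).div ((Real.hasDerivAt_sqrt hs.ne').mul (hasDerivAt_id s))
    (mul_pos hq hs).ne').sub ((hd.pow 2).div ((hasDerivAt_id s).pow 2) (pow_pos hs 2).ne')
  rw [h1.deriv_eq]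
  refine Eq.trans h2.deriv ?_
  simp only [id, Pi.mul_apply, Pi.pow_apply]
  generalize √s = q at *
  subst hqq
  field_simp
  simp
  ring

/-- Since A = f²/s, this identifies the tangential curvature α/A as (1 - f'²)/f². -/
lemma IsWarping.mul_α {s : ℝ} (hs : 0 < s) :
    s * hf.radialData.α s = 1 - deriv f √s ^ 2 := by
  have hA := hf.conformalCoeff_eq hs
  have hA' := hf.deriv_conformalCoeff hs
  have hB := hf.radialCoeff_eq hs
  have hq := Real.sqrt_pos.2 hs
  have hqq := Real.sq_sqrt hs.le
  have hp := hf.pos hq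
  simp only [RadialData.α, RadialData.P, RadialData.Q, IsWarping.radialData]
  rw [hA', hA, hB]
  -- With s = q², both sides become rational in q, f(q) and f'(q).
  generalize √s = q at *
  subst hqq
  field_simp
  ring

/-- The curvature of the planes containing the radial direction; concavity of f enters only through
its sign and through 0 ≤ f' ≤ 1 in α. -/
lemma IsWarping.α_add_mul_β {s : ℝ} (hs : 0 < s) :
    hf.radialData.α s + s * hf.radialData.β s = -deriv (deriv f) √s / f √s := by
  have hA := hf.conformalCoeff_eq hs
  have hA' := hf.deriv_conformalCoeff hs
  have hA'' := hf.deriv_deriv_conformalCoeff hs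
  have hB := hf.radialCoeff_eq hs
  have hB' : deriv (radialCoeff f) s = -(deriv (conformalCoeff f) s + radialCoeff f s) / s := by
    have : deriv (conformalCoeff f) s + (radialCoeff f s + s * deriv (radialCoeff f) s) = 0 :=
      hf.radialData.deriv_add s
    field_simp
    linarith
  have hq := Real.sqrt_pos.2 hs
  have hqq := Real.sq_sqrt hs.le
  have hp := hf.pos hq
  simp only [RadialData.α, RadialData.β, (hf.radialData.hasDerivAt_P s).deriv, RadialData.S,
    RadialData.P, RadialData.Q]
  simp only [IsWarping.radialData]
  rw [hB', hA'', hA', hA, hB]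
  generalize √s = q at *
  subst hqq
  field_simp
  ring

lemma IsWarping.α_nonneg {s : ℝ} (hs : 0 ≤ s) : 0 ≤ hf.radialData.α s := by
  have hpos : ∀ s, 0 < s → 0 ≤ hf.radialData.α s := fun s hs => by
    refine nonneg_of_mul_nonneg_right (a := s) ?_ hs
    rw [hf.mul_α hs]
    have h1 := hf.deriv_nonneg √s
    have h2 := hf.deriv_le_one (Real.sqrt_nonneg s)
    nlinarith
  rcases hs.eq_or_lt with rfl | hs
  -- At s = 0 the metric is Euclidean nearby. The coefficients are constant for all s < 1, negative
  -- s included, so the two-sided derivatives at 0 vanish.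
  · have hc : conformalCoeff f =ᶠ[𝓝 0] fun _ => 1 := by
      filter_upwards [Iio_mem_nhds one_pos] with r hr using conformalCoeff_of_lt hr
    simp [RadialData.α, RadialData.P, RadialData.Q, IsWarping.radialData, hc.deriv_eq,
      radialCoeff_of_lt]
  · exact hpos s hs

lemma warpedMetric_nonnegSectionalCurvature (n : ℕ) :
    (warpedMetric n hf).NonnegSectionalCurvature := by
  refine (hf.isMetric n).nonnegSectionalCurvature (fun s _ => hf.radialCoeff_nonneg s)
    (fun s => hf.α_nonneg) fun s hs => ?_
  rcases hs.eq_or_lt with rfl | hs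
  · simpa using hf.α_nonneg le_rfl
  · rw [hf.α_add_mul_β hs]
    exact div_nonneg (neg_nonneg.2 (hf.deriv_deriv_nonpos _)) (hf.nonneg _ (Real.sqrt_nonneg s))

end

end

theorem mainTheorem7 (n : ℕ) (hn : 2 ≤ n) :
    ∃ (f : ℝ → ℝ) (R : ℕ → ℝ)
      (g : RiemannianGeometry.Metric n (EuclideanSpace ℝ (Fin n))),
      RiemannianGeometry.IsAlternatingWarping f R ∧
      g.IsRotationallySymmetric f ∧
      g.IsOpenManifold ∧
      g.NonnegSectionalCurvature ∧
      ∀ p : EuclideanSpace ℝ (Fin n), g.IV p = 1 ∧ g.SV p = (n : EReal) := by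
  obtain ⟨f, R, hw, hf⟩ := exists_isAlternatingWarping
  have hn' : 0 < n := by omega
  exact ⟨f, R, warpedMetric n hw, hf, warpedMetric_isRotationallySymmetric hw,
    warpedMetric_isOpenManifold hw hn', warpedMetric_nonnegSectionalCurvature hw n,
    warpedMetric_IV_SV hn' hw hf⟩
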